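/- **Setting.** Let $\Sigma\in\mathbb R^{n\times n}$ be positive definite, with positive definite square root $\sqrt\Sigma$. Let $a_1,\dots,a_m\sim N(0,\Sigma)$ be independent, let $\mathcal Y\subset\mathbb R$ be closed, and let $f:\mathbb R\to\mathcal Y$ be a (possibly random) function. The observations are $y_i=f(\langle a_i,x_0\rangle)$, $i=1,\dots,m$, where each measurement uses its own independent copy of $f$ and these copies are independent of $a_1,\dots,a_m$. One is given arbitrarily perturbed observations $\tilde y=(\tilde y_1,\dots,\tilde y_m)\in\mathcal Y^m$ (possibly random and depending on all $a_i,y_i$), with noise level $\varepsilon=\big(\tfrac1m\sum_{i=1}^m|\tilde y_i-y_i|^2\big)^{1/2}$. Let $\mathcal L:\mathbb R\times\mathcal Y\to\mathbb R$ be a loss function; $\mathcal L',\mathcal L''$ denote derivatives in the first variable. For $K\subset\mathbb R^n$, an *estimator* is any minimizer $\hat x\in K$ of $x\mapsto\frac1m\sum_{i=1}^m\mathcal L(\langle a_i,x\rangle,\tilde y_i)$ over $K$. For $g\sim N(0,1)$ independent of $f$, the parameters $\mu\in\mathbb R$ and $\sigma,\eta\ge 0$ satisfy $$0=\mathbb E[\mathcal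 L'(\mu g,f(g))\,g],\qquad \sigma^2=\mathbb E[\mathcal L'(\mu g,f(g))^2],\qquad \eta^2=\mathbb E[\mathcal L'(\mu g,f(g))^2g^2]$$ (it is assumed that such a $\mu$ exists and that these expectations are finite). For $t>0$ and $L\subset\mathbb R^n$ put $d_t(L)=w_t(L)^2/t^2$, where $w_t(L)=\mathbb E\sup_{x\in L,\ \|x\|_2\le t}\langle \mathbf g,x\rangle$, $\mathbf g\sim N(0,I_n)$. **Theorem.** There are numerical constants $\kappa_1,\kappa_2,C_1,c>0$ such that for all $\delta\in(0,1)$, $C_{M,N}>0$ and $C_{\mathcal L'}>0$ there is a constant $C_2>0$, depending only on $\delta$, $C_{M,N}$, $C_{\mathcal L'}$, such that the following holds in every setting as above, for every $t>0$. Assume - (L1) $\mathcal L$ is continuously differentiable in the first variable and $|\mathcal L'(v,y)-\mathcal L'(v,\tilde y)|\le C_{\mathcal L'}|y-\tilde y|$ for all $v\in\mathbb R$, $y,\tilde y\in\mathcal Y$; - (L2) $\mathcal L$ is convex in the first variable; - (L3) $\mathcal L$ is twice continuously differentiable in the first variable; - (L4) there are $0<M,N\le\infty$ with $M\ge\max\{32t,\kappa_1|\mu|\}$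 and $N\ge\kappa_2\,\mathbb E|f(g)|+\max_i|\tilde y_i-y_i|$ such that $\mathcal L''(v,y)\ge C_{M,N}$ for all $v\in(-M,M)$ and $y\in(-N,N)\cap\mathcal Y$. Let $\|\sqrt\Sigma x_0\|_2=1$, let $K\subset\mathbb R^n$ be convex with $\mu x_0\in K$, put $d=d_t\big(\sqrt\Sigma(K-\mu x_0)\big)$, and assume $m\ge C_1\,d$ and $$t>C_2\Big(\frac{\sigma\sqrt{d}+\eta}{\sqrt m}+\varepsilon\Big).$$ Then, with probability at least $1-\delta-e^{-cm}$, every minimizer $\hat x$ satisfies $\|\sqrt\Sigma(\hat x-\mu x_0)\|_2\le t$. If moreover $m\ge C_1\log(2/\delta)\,d$, this holds with probability at least $1-\delta$. Here, if $\tilde y$ (and hence $\varepsilon$ and $\max_i|\tilde y_i-y_i|$) is random, the two conditions involving it are understood realization-wise: the stated bound is a bound on the probability that both conditions hold and yet some minimizer violates the conclusion. -/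

import Mathlib

open MeasureTheory ProbabilityTheory
open scoped ENNReal MatrixOrder

/-- The Gaussian mean width `w(L) = E[sup_{x ∈ L} ⟨g, x⟩]`, `g ∼ N(0, Iₙ)`, of a (nonempty, bounded)
set `L ⊆ ℝⁿ`. -/
noncomputable def meanWidth {n : ℕ} (L : Set (EuclideanSpace ℝ (Fin n))) : ℝ :=
  ∫ g, (⨆ x : L, inner ℝ g (x : EuclideanSpace ℝ (Fin n)))
    ∂(stdGaussian (EuclideanSpace ℝ (Fin n)))

/-- The local mean width `w_t(L) = w(L ∩ t B₂ⁿ)`. -/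
noncomputable def localMeanWidth {n : ℕ} (t : ℝ) (L : Set (EuclideanSpace ℝ (Fin n))) : ℝ :=
  meanWidth (L ∩ Metric.closedBall 0 t)

/-- The local effective dimension `d_t(L) = w_t(L)² / t²`, for `t > 0`. -/
noncomputable def effDim {n : ℕ} (t : ℝ) (L : Set (EuclideanSpace ℝ (Fin n))) : ℝ :=
  localMeanWidth t L ^ 2 / t ^ 2

/-- The positive definite square root `√S` of a positive definite matrix `S`, acting on `ℝⁿ`. -/
noncomputable def sqrtCov {n : ℕ} (S : Matrix (Fin n) (Fin n) ℝ) :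
    EuclideanSpace ℝ (Fin n) →L[ℝ] EuclideanSpace ℝ (Fin n) :=
  Matrix.toEuclideanCLM (𝕜 := ℝ) (CFC.sqrt S)

/-- The Gaussian single-index measurement process: `a₁, …, aₘ` are independent `N(0, S)` vectors, the
random non-linearity `v ↦ f v ϑ` has internal randomness `ϑ ∼ ν`, and measurement `i` uses its own
independent copy `θᵢ` of it; all these copies are independent of the measurement vectors. -/
structure IsMeasurementModel {Ω Θ : Type*} [MeasurableSpace Ω] [MeasurableSpace Θ] {n m : ℕ}
    {Y : Set ℝ} (P : Measure Ω) (ν : Measure Θ) (S : Matrix (Fin n) (Fin n) ℝ)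
    (a : Fin m → Ω → EuclideanSpace ℝ (Fin n)) (θ : Fin m → Ω → Θ) (f : ℝ → Θ → Y) : Prop where
  law_a : ∀ i, HasLaw (a i) (multivariateGaussian 0 S) P
  indep_a : iIndepFun a P
  law_θ : ∀ i, HasLaw (θ i) ν P
  indep_θ : iIndepFun θ P
  indep_a_θ : IndepFun (fun ω i => a i ω) (fun ω i => θ i ω) P
  measurable_f : Measurable (Function.uncurry f)

/-- The unperturbed observations `yᵢ = f(⟨aᵢ, x₀⟩)`. -/
noncomputable def observation {Ω Θ : Type*} {n m : ℕ} {Y : Set ℝ}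
    (a : Fin m → Ω → EuclideanSpace ℝ (Fin n)) (θ : Fin m → Ω → Θ) (f : ℝ → Θ → Y)
    (x₀ : EuclideanSpace ℝ (Fin n)) (ω : Ω) (i : Fin m) : Y :=
  f (inner ℝ (a i ω) x₀) (θ i ω)

/-- The adversarial noise parameter `ε = (m⁻¹ ∑ᵢ |ỹᵢ - yᵢ|²)^{1/2}`. -/
noncomputable def advNoise {m : ℕ} {Y : Set ℝ} (y y' : Fin m → Y) : ℝ :=
  √((1 / (m : ℝ)) * ∑ i, |(y' i : ℝ) - (y i : ℝ)| ^ 2)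

/-- The maximal perturbation `‖ỹ - y‖_∞`. -/
noncomputable def maxNoise {m : ℕ} {Y : Set ℝ} (y y' : Fin m → Y) : ℝ≥0∞ :=
  ⨆ i, ‖(y' i : ℝ) - (y i : ℝ)‖ₑ

/-- The first derivative `L'(v, y) = ∂L/∂v (v, y)`. -/
noncomputable def lossDeriv {Y : Set ℝ} (L : ℝ → Y → ℝ) (v : ℝ) (y : Y) : ℝ :=
  deriv (fun u => L u y) v

/-- The second derivative `L''(v, y) = ∂²L/∂v² (v, y)`. -/
noncomputable def lossDeriv2 {Y : Set ℝ} (L : ℝ → Y → ℝ) (v : ℝ) (y : Y) : ℝ :=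
  deriv (fun u => lossDeriv L u y) v

/-- The loss is continuously differentiable in the first variable, and its derivative is
`C`-Lipschitz in the second variable. -/
def LossLipschitz {Y : Set ℝ} (L : ℝ → Y → ℝ) (C : ℝ) : Prop :=
  (∀ y, ContDiff ℝ 1 (fun v => L v y)) ∧
    ∀ (v : ℝ) (y y' : Y), |lossDeriv L v y - lossDeriv L v y'| ≤ C * |(y : ℝ) - (y' : ℝ)|

/-- The loss is convex in the first variable. -/
def LossConvex {Y : Set ℝ} (L : ℝ → Y → ℝ) : Prop :=
  ∀ y, ConvexOn ℝ Set.univ (fun v => L v y)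

/-- The loss is twice continuously differentiable in the first variable. -/
def LossSmooth {Y : Set ℝ} (L : ℝ → Y → ℝ) : Prop :=
  ∀ y, ContDiff ℝ 2 (fun v => L v y)

/-- `L'' ≥ C` on `(-M, M) × ((-N, N) ∩ Y)`, where `M, N ∈ [0, ∞]`. -/
def LossCurved {Y : Set ℝ} (L : ℝ → Y → ℝ) (M N : ℝ≥0∞) (C : ℝ) : Prop :=
  ∀ (v : ℝ) (y : Y), ‖v‖ₑ < M → ‖(y : ℝ)‖ₑ < N → C ≤ lossDeriv2 L v y

/-- `E |f(g)| ∈ [0, ∞]` for `g ∼ N(0, 1)` independent of `f`. -/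
noncomputable def meanAbsOutput {Θ : Type*} [MeasurableSpace Θ] {Y : Set ℝ} (ν : Measure Θ)
    (f : ℝ → Θ → Y) : ℝ≥0∞ :=
  ∫⁻ p, ‖(f p.1 p.2 : ℝ)‖ₑ ∂((gaussianReal 0 1).prod ν)

/-- The model parameters `μ, σ, η` of the pair `(L, f)`: with `g ∼ N(0, 1)` independent of `f`,
`0 = E[L'(μ g, f(g)) g]`, `σ² = E[L'(μ g, f(g))²]`, `η² = E[L'(μ g, f(g))² g²]`, `σ, η ≥ 0`,
where all three expectations are required to exist. -/
structure IsModelParameter {Θ : Type*} [MeasurableSpace Θ] {Y : Set ℝ} (ν : Measure Θ)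
    (f : ℝ → Θ → Y) (L : ℝ → Y → ℝ) (μ σ η : ℝ) : Prop where
  integrable_μ : Integrable (fun p : ℝ × Θ => lossDeriv L (μ * p.1) (f p.1 p.2) * p.1)
    ((gaussianReal 0 1).prod ν)
  eq_μ : 0 = ∫ p : ℝ × Θ, lossDeriv L (μ * p.1) (f p.1 p.2) * p.1 ∂((gaussianReal 0 1).prod ν)
  integrable_σ : Integrable (fun p : ℝ × Θ => lossDeriv L (μ * p.1) (f p.1 p.2) ^ 2)
    ((gaussianReal 0 1).prod ν)
  nonneg_σ : 0 ≤ σ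
  eq_σ : σ ^ 2 = ∫ p : ℝ × Θ, lossDeriv L (μ * p.1) (f p.1 p.2) ^ 2 ∂((gaussianReal 0 1).prod ν)
  integrable_η : Integrable (fun p : ℝ × Θ => lossDeriv L (μ * p.1) (f p.1 p.2) ^ 2 * p.1 ^ 2)
    ((gaussianReal 0 1).prod ν)
  nonneg_η : 0 ≤ η
  eq_η : η ^ 2 = ∫ p : ℝ × Θ, lossDeriv L (μ * p.1) (f p.1 p.2) ^ 2 * p.1 ^ 2
    ∂((gaussianReal 0 1).prod ν)

/-- The empirical loss `x ↦ m⁻¹ ∑ᵢ L(⟨aᵢ, x⟩, ỹᵢ)`. -/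
noncomputable def empLoss {n m : ℕ} {Y : Set ℝ} (L : ℝ → Y → ℝ)
    (a : Fin m → EuclideanSpace ℝ (Fin n)) (y' : Fin m → Y) (x : EuclideanSpace ℝ (Fin n)) : ℝ :=
  (1 / (m : ℝ)) * ∑ i, L (inner ℝ (a i) x) (y' i)

/-- `x` minimizes the empirical loss over `K`. -/
def IsEstimator {n m : ℕ} {Y : Set ℝ} (L : ℝ → Y → ℝ) (K : Set (EuclideanSpace ℝ (Fin n)))
    (a : Fin m → EuclideanSpace ℝ (Fin n)) (y' : Fin m → Y) (x : EuclideanSpace ℝ (Fin n)) : Prop :=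
  x ∈ K ∧ ∀ z ∈ K, empLoss L a y' x ≤ empLoss L a y' z

/-! After whitening, the vectors bᵢ = Σ^{-1/2} aᵢ are standard Gaussian, z = √Σ x₀ is a unit vector,
and T = {x : t x ∈ √Σ(K - μ x₀), ‖x‖ ≤ 1} has Gaussian width w with d = w². If a minimizer misses
the target by more than t, convexity of K and of the loss gives a unit vector h ∈ T such that the
step t h does not increase the empirical loss (`IsEstimator.exists_direction`). On a good event this
is impossible once t is large.

Put gᵢ = ⟨z, bᵢ⟩ and ξᵢ = L'(μ gᵢ, yᵢ). The increment of the loss at sample i is at least a linear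
term t ξᵢ ⟨bᵢ, h⟩ plus a curvature term, minus C t |ỹᵢ - yᵢ| |⟨bᵢ, h⟩| for the perturbation
(`le_loss_increment`).

Curvature: the square of ⟨bᵢ, h⟩ is replaced by the bounded Lipschitz minorant `hat`, with Gaussian
mean α. Its empirical mean is at least 3α/4 uniformly over unit vectors of T, by symmetrization and
contraction carried out one sample at a time with Gaussian vectors (`lintegral_exp_affSup_sum_le`).
Samples with large |gᵢ| or |yᵢ| may have no curvature; a Chernoff bound shows that they cost at most
α/4.

Linear term: bᵢ is split along z and orthogonally to it. Along z, the variables ξᵢ gᵢ are centered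
by the choice of μ, and Chebyshev gives order √m η. The orthogonal parts are independent of the
multipliers ξᵢ, so conditionally their weighted sum is Gaussian and its supremum has mean at most √m
σ w (`lintegral_affSup_multiplier_le`). Only these two Markov bounds make C₂ depend on δ; the other
events fail with exponentially small probability.

Perturbation: Cauchy–Schwarz reduces it to ∑ ⟨bᵢ, h⟩² ≤ 100 m. The exponential of this quadratic
form is linearized by an auxiliary Gaussian vector and controlled by the concentration bound
`integral_exp_affSup_zero_le`.

Together, t is at most a constant times (σ w + η)/√m + ε, contrary to the assumption on t. -/

/-! ### Identities in law for standard Gaussian vectors. -/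

section GaussianLaws

variable {E : Type*} [NormedAddCommGroup E] [InnerProductSpace ℝ E] [FiniteDimensional ℝ E]
  [MeasurableSpace E] [BorelSpace E]

open Complex in
/-- A sum `U x + V y` of linear images of independent standard Gaussian vectors is standard
Gaussian, if the covariances `U U†` and `V V†` add up to the identity. -/
lemma map_add_prod_stdGaussian (U V U' V' : E →L[ℝ] E)
    (hU : ∀ x z, inner ℝ (U x) z = inner ℝ x (U' z))
    (hV : ∀ x z, inner ℝ (V x) z = inner ℝ x (V' z))
    (h : ∀ z, ‖U' z‖ ^ 2 + ‖V' z‖ ^ 2 = ‖z‖ ^ 2) :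
    ((stdGaussian E).prod (stdGaussian E)).map (fun p => U p.1 + V p.2) = stdGaussian E := by
  have : IsFiniteMeasure
      (((stdGaussian E).prod (stdGaussian E)).map (fun p => U p.1 + V p.2)) :=
    Measure.isFiniteMeasure_map _ _
  apply Measure.ext_of_charFun
  ext z
  rw [charFun_stdGaussian, charFun_apply, integral_map (by fun_prop) (by fun_prop)]
  have : ∀ p : E × E, exp ((inner ℝ (U p.1 + V p.2) z : ℝ) * I)
      = exp ((inner ℝ p.1 (U' z) : ℝ) * I) * exp ((inner ℝ p.2 (V' z) : ℝ) * I) := by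
    intro p
    rw [inner_add_left, hU, hV, ← exp_add]
    push_cast
    ring_nf
  simp_rw [this]
  rw [integral_prod_mul (fun x : E => exp ((inner ℝ x (U' z) : ℝ) * I))
    (fun x : E => exp ((inner ℝ x (V' z) : ℝ) * I)), ← charFun_apply, ← charFun_apply,
    charFun_stdGaussian, charFun_stdGaussian, ← exp_add]
  congr 1
  have := h z
  rw [← add_div, ← neg_add]
  norm_cast
  rw [this]

open Complex in
/-- A linear combination of independent standard Gaussian vectors is a multiple of a standard
Gaussian vector. -/
lemma map_sum_smul_pi_stdGaussian {ι : Type*} [Fintype ι] (c : ι → ℝ) :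
    (Measure.pi fun _ : ι => stdGaussian E).map (fun b => ∑ i, c i • b i)
      = (stdGaussian E).map (fun g => √(∑ i, c i ^ 2) • g) := by
  have : IsFiniteMeasure ((Measure.pi fun _ : ι => stdGaussian E).map
      (fun b => ∑ i, c i • b i)) := Measure.isFiniteMeasure_map _ _
  have : IsFiniteMeasure ((stdGaussian E).map (fun g => √(∑ i, c i ^ 2) • g)) :=
    Measure.isFiniteMeasure_map _ _
  apply Measure.ext_of_charFun
  ext z
  rw [charFun_map_smul, charFun_stdGaussian, charFun_apply,
    integral_map (Measurable.aemeasurable (by fun_prop)) (by fun_prop)]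
  simp_rw [sum_inner, ofReal_sum, Finset.sum_mul, exp_sum, real_inner_smul_left]
  rw [integral_fintype_prod_eq_prod (f := fun i (x : E) =>
    exp (((c i * inner ℝ x z : ℝ) : ℂ) * I))]
  have : ∀ i, ∫ x : E, exp (((c i * inner ℝ x z : ℝ) : ℂ) * I) ∂stdGaussian E
      = exp (-((c i) ^ 2 * ‖z‖ ^ 2 : ℝ) / 2) := by
    intro i
    have := charFun_stdGaussian (c i • z)
    rw [charFun_apply] at this
    simp_rw [real_inner_smul_right] at this
    rw [this, norm_smul]
    congr 2
    rw [← ofReal_pow, mul_pow, Real.norm_eq_abs, sq_abs]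
  simp_rw [this]
  rw [← exp_sum]
  congr 1
  rw [norm_smul, Real.norm_of_nonneg (Real.sqrt_nonneg _), ← ofReal_pow, mul_pow,
    Real.sq_sqrt (by positivity), ← Finset.sum_div, Finset.sum_mul]
  simp

lemma map_smul_add_smul_prod_stdGaussian (a b : ℝ) :
    ((stdGaussian E).prod (stdGaussian E)).map (fun p => a • p.1 + b • p.2)
      = (stdGaussian E).map (fun g => √(a ^ 2 + b ^ 2) • g) := by
  have h := map_sum_smul_pi_stdGaussian (E := E) ![a, b]
  have h2 := (measurePreserving_finTwoArrow_vec (stdGaussian E) (stdGaussian E)).map_eq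
  have h3 : (Measure.pi fun _ : Fin 2 => stdGaussian E) =
      Measure.pi ![stdGaussian E, stdGaussian E] := by
    congr 1
    ext i
    fin_cases i <;> rfl
  rw [← h2, Measure.map_map (by fun_prop) (by fun_prop), ← h3]
  simpa [Fin.sum_univ_two, Function.comp_def] using h

/-- The marginal of a standard Gaussian vector along a unit vector is `N(0, 1)`. -/
lemma map_inner_stdGaussian {z : E} (hz : ‖z‖ = 1) :
    (stdGaussian E).map (fun b => inner ℝ b z) = gaussianReal 0 1 := by
  have : IsFiniteMeasure ((stdGaussian E).map (fun b => inner ℝ b z)) :=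
    Measure.isFiniteMeasure_map _ _
  apply Measure.ext_of_charFun
  ext s
  rw [charFun_gaussianReal, charFun_apply_real, integral_map (by fun_prop) (by fun_prop)]
  have := charFun_stdGaussian (s • z)
  rw [charFun_apply] at this
  simp_rw [real_inner_smul_right] at this
  push_cast at this
  rw [this, norm_smul, hz]
  congr 1
  simp [← Complex.ofReal_pow]
  ring

lemma integral_exp_mul_inner_stdGaussian (s : ℝ) (z : E) :
    ∫ b, Real.exp (s * inner ℝ z b) ∂stdGaussian E = Real.exp (s ^ 2 * ‖z‖ ^ 2 / 2) := by
  have h := mgf_gaussianReal (p := stdGaussian E) (X := fun b => inner ℝ z b)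
    (μ := 0) (v := (‖z‖ ^ 2).toNNReal) ?_ s
  · rw [mgf] at h
    rw [h, Real.coe_toNNReal _ (by positivity)]
    congr 1
    ring
  · have h1 := IsGaussian.map_eq_gaussianReal (μ := stdGaussian E) (innerSL ℝ z)
    have h2 := integral_strongDual_stdGaussian (innerSL ℝ z)
    rw [variance_dual_stdGaussian, h2, innerSL_apply_norm] at h1
    exact h1

lemma integrable_exp_mul_norm_stdGaussian (s : ℝ) :
    Integrable (fun b : E => Real.exp (s * ‖b‖)) (stdGaussian E) := by
  -- Fernique's theorem, combined with s‖b‖ ≤ s²/(4C) + C‖b‖².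
  obtain ⟨C, hC, h⟩ := IsGaussian.exists_integrable_exp_sq (stdGaussian E)
  refine (h.const_mul (Real.exp (s ^ 2 / (4 * C)))).mono' (by fun_prop) ?_
  refine Filter.Eventually.of_forall fun b => ?_
  rw [Real.norm_of_nonneg (Real.exp_nonneg _), ← Real.exp_add]
  gcongr
  rw [div_add' _ _ _ (by positivity), le_div_iff₀ (by positivity)]
  nlinarith [sq_nonneg (s - 2 * C * ‖b‖)]

lemma map_neg_stdGaussian : (stdGaussian E).map (fun b => -b) = stdGaussian E :=
  stdGaussian_map (LinearIsometryEquiv.neg ℝ (E := E))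

end GaussianLaws

/-! ### Suprema of affine functions over a subset of the unit ball. -/

section AffSup

lemma bddAbove_range_zero {ι : Type*} : BddAbove (Set.range (0 : ι → ℝ)) :=
  ⟨0, by rintro _ ⟨x, rfl⟩; simp⟩

variable {E : Type*} [NormedAddCommGroup E] [InnerProductSpace ℝ E]

/-- The supremum over `x ∈ T` of the affine functions `g ↦ A x + ⟨g, x⟩`. -/
noncomputable def affSup (T : Set E) (A : T → ℝ) (g : E) : ℝ :=
  ⨆ x : T, (A x + inner ℝ g (x : E))

variable {T : Set E} {A : T → ℝ}

lemma bddAbove_affSup (hT : ∀ x ∈ T, ‖x‖ ≤ 1) (hA : BddAbove (Set.range A)) (g : E) :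
    BddAbove (Set.range fun x : T => A x + inner ℝ g (x : E)) := by
  obtain ⟨a, ha⟩ := hA
  refine ⟨a + ‖g‖, ?_⟩
  rintro _ ⟨x, rfl⟩
  have h1 := ha ⟨x, rfl⟩
  have h2 := real_inner_le_norm g (x : E)
  have h3 := mul_le_of_le_one_right (norm_nonneg g) (hT x x.2)
  simp only
  linarith

lemma le_affSup (hT : ∀ x ∈ T, ‖x‖ ≤ 1) (hA : BddAbove (Set.range A)) (g : E) (x : T) :
    A x + inner ℝ g (x : E) ≤ affSup T A g :=
  le_ciSup (bddAbove_affSup hT hA g) x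

lemma affSup_le [Nonempty T] {g : E} {c : ℝ} (h : ∀ x : T, A x + inner ℝ g (x : E) ≤ c) :
    affSup T A g ≤ c := ciSup_le h

lemma affSup_le_add [Nonempty T] (hT : ∀ x ∈ T, ‖x‖ ≤ 1) {B : T → ℝ}
    (hB : BddAbove (Set.range B)) {g g' : E} {c : ℝ}
    (h : ∀ x, A x ≤ B x + c) : affSup T A g ≤ affSup T B g' + (c + ‖g - g'‖) := by
  refine affSup_le fun x => ?_
  have h1 := le_affSup hT hB g' x
  have h2 := real_inner_le_norm (g - g') (x : E)
  have h3 := mul_le_of_le_one_right (norm_nonneg (g - g')) (hT x x.2)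
  rw [inner_sub_left] at h2
  linarith [h x]

lemma lipschitzWith_affSup [Nonempty T] (hT : ∀ x ∈ T, ‖x‖ ≤ 1) (hA : BddAbove (Set.range A)) :
    LipschitzWith 1 (affSup T A) := by
  refine LipschitzWith.of_le_add fun g g' => ?_
  have := affSup_le_add hT hA (A := A) (g := g) (g' := g') (c := 0) (by simp)
  rwa [zero_add, ← dist_eq_norm] at this

lemma abs_affSup_le [Nonempty T] (hT : ∀ x ∈ T, ‖x‖ ≤ 1) (hA : BddAbove (Set.range A)) (g : E) :
    |affSup T A g| ≤ |affSup T A 0| + ‖g‖ := by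
  have := (lipschitzWith_affSup hT hA).dist_le_mul g 0
  rw [Real.dist_eq, dist_zero_right, NNReal.coe_one, one_mul] at this
  have h2 := abs_sub_abs_le_abs_sub (affSup T A g) (affSup T A 0)
  linarith

lemma affSup_zero_zero [Nonempty T] : affSup T 0 0 = 0 := by
  simp [affSup]

lemma abs_affSup_zero_le [Nonempty T] (hT : ∀ x ∈ T, ‖x‖ ≤ 1) (g : E) :
    |affSup T 0 g| ≤ ‖g‖ := by
  have := abs_affSup_le (A := 0) hT ⟨0, by rintro _ ⟨x, rfl⟩; simp⟩ g
  rwa [affSup_zero_zero, abs_zero, zero_add] at this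

lemma affSup_zero_smul {c : ℝ} (hc : 0 ≤ c) (g : E) :
    affSup T 0 (c • g) = c * affSup T 0 g := by
  simp only [affSup, Pi.zero_apply, zero_add, real_inner_smul_left]
  exact (Real.mul_iSup_of_nonneg hc _).symm

variable [FiniteDimensional ℝ E] [MeasurableSpace E] [BorelSpace E]

lemma integrable_norm_stdGaussian : Integrable (fun g : E => ‖g‖) (stdGaussian E) :=
  (IsGaussian.integrable_id (μ := stdGaussian E)).norm

lemma integrable_affSup [Nonempty T] (hT : ∀ x ∈ T, ‖x‖ ≤ 1) (hA : BddAbove (Set.range A))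
    (v : E) (s : ℝ) : Integrable (fun g => affSup T A (v + s • g)) (stdGaussian E) := by
  have hc := (lipschitzWith_affSup hT hA).continuous
  refine ((integrable_const (|affSup T A 0| + ‖v‖)).add
    ((integrable_norm_stdGaussian (E := E)).const_mul |s|)).mono' (by fun_prop)
    (Filter.Eventually.of_forall fun g => ?_)
  refine (abs_affSup_le hT hA _).trans ?_
  have := norm_add_le v (s • g)
  rw [norm_smul, Real.norm_eq_abs] at this
  simp only [Pi.add_apply]
  linarith

lemma integrable_affSup_smul [Nonempty T] (hT : ∀ x ∈ T, ‖x‖ ≤ 1) (hA : BddAbove (Set.range A))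
    (s : ℝ) : Integrable (fun g => affSup T A (s • g)) (stdGaussian E) := by
  simpa using integrable_affSup hT hA 0 s

lemma integrable_affSup_id [Nonempty T] (hT : ∀ x ∈ T, ‖x‖ ≤ 1) (hA : BddAbove (Set.range A)) :
    Integrable (affSup T A) (stdGaussian E) := by
  simpa using integrable_affSup hT hA 0 1

lemma integral_affSup_zero_nonneg [Nonempty T] (hT : ∀ x ∈ T, ‖x‖ ≤ 1) :
    0 ≤ ∫ g, affSup T 0 g ∂stdGaussian E := by
  obtain ⟨x⟩ := ‹Nonempty T›
  have : Nonempty T := ⟨x⟩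
  have h := integral_strongDual_stdGaussian (innerSL ℝ (x : E))
  rw [← h]
  refine integral_mono ((IsGaussian.integrable_dual _ _)) (integrable_affSup_id hT bddAbove_range_zero)
    fun g => ?_
  have := le_affSup hT bddAbove_range_zero g x
  simpa [real_inner_comm] using this

lemma integrable_exp_mul_affSup_zero [Nonempty T] (hT : ∀ x ∈ T, ‖x‖ ≤ 1) (s : ℝ) :
    Integrable (fun g => Real.exp (s * affSup T 0 g)) (stdGaussian E) := by
  have hc := (lipschitzWith_affSup (A := 0) hT bddAbove_range_zero).continuous
  refine (integrable_exp_mul_norm_stdGaussian |s|).mono' (by fun_prop)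
    (Filter.Eventually.of_forall fun g => ?_)
  rw [Real.norm_of_nonneg (Real.exp_nonneg _)]
  refine Real.exp_le_exp.2 ((le_abs_self _).trans ?_)
  rw [abs_mul]
  gcongr
  exact abs_affSup_zero_le hT g

/-- The inner estimate behind the concentration of the support function: rotating `x` by 45 degrees
towards an independent Gaussian vector. -/
lemma integral_exp_affSup_sub_rotation_le [Nonempty T] (hT : ∀ x ∈ T, ‖x‖ ≤ 1) {s r : ℝ}
    (hs : 0 ≤ s) (hr : r ^ 2 = 1 / 2) (hr0 : 0 ≤ r) (x : E) :
    ∫ y, Real.exp (s * (affSup T 0 x - affSup T 0 (r • x + r • y))) ∂stdGaussian E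
      ≤ Real.exp (s ^ 2 / 4 + s * (1 - r) * affSup T 0 x) := by
  have hr1 : r ≤ 1 := by nlinarith
  have key : ∀ ε > 0, ∫ y, Real.exp (s * (affSup T 0 x - affSup T 0 (r • x + r • y)))
      ∂stdGaussian E ≤ Real.exp (s * ε + (s ^ 2 / 4 + s * (1 - r) * affSup T 0 x)) := by
    intro ε hε
    -- An ε-maximizer at x suffices, T not being assumed compact. Testing the supremum at r x + r y
    -- with this same h leaves only the linear function ⟨y, h⟩, whose exponential moment is
    -- explicit.
    obtain ⟨h, hh⟩ := exists_lt_of_lt_ciSup (sub_lt_self (affSup T 0 x) hε)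
    have hle := le_affSup hT bddAbove_range_zero x h
    simp only [Pi.zero_apply, zero_add] at hh hle
    have hb : ∀ y, Real.exp (s * (affSup T 0 x - affSup T 0 (r • x + r • y)))
        ≤ Real.exp (s * ε + s * (1 - r) * affSup T 0 x) *
          Real.exp ((-(s * r)) * inner ℝ (h : E) y) := by
      intro y
      rw [← Real.exp_add]
      refine Real.exp_le_exp.2 ?_
      have h2 := le_affSup hT bddAbove_range_zero (r • x + r • y) h
      simp only [Pi.zero_apply, zero_add, inner_add_left, real_inner_smul_left] at h2
      rw [real_inner_comm y]
      have h3 : affSup T 0 x - affSup T 0 (r • x + r • y)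
          ≤ ε + (1 - r) * affSup T 0 x - r * inner ℝ y (h : E) := by
        nlinarith
      nlinarith
    have hi : Integrable (fun y => Real.exp (s * ε + s * (1 - r) * affSup T 0 x) *
          Real.exp ((-(s * r)) * inner ℝ (h : E) y)) (stdGaussian E) := by
      refine Integrable.const_mul ?_ _
      refine (integrable_exp_mul_norm_stdGaussian |s * r|).mono' (by fun_prop)
        (Filter.Eventually.of_forall fun y => ?_)
      rw [Real.norm_of_nonneg (Real.exp_nonneg _)]
      refine Real.exp_le_exp.2 ((le_abs_self _).trans ?_)
      rw [abs_mul, abs_neg]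
      gcongr
      exact (abs_real_inner_le_norm _ _).trans
        (mul_le_of_le_one_left (norm_nonneg _) (hT h h.2))
    refine (integral_mono_of_nonneg (Filter.Eventually.of_forall fun _ => Real.exp_nonneg _) hi
      (Filter.Eventually.of_forall hb)).trans ?_
    rw [integral_const_mul, integral_exp_mul_inner_stdGaussian, ← Real.exp_add]
    refine Real.exp_le_exp.2 ?_
    have h4 : ‖(h : E)‖ ^ 2 ≤ 1 := pow_le_one₀ (norm_nonneg _) (hT h h.2)
    have : (-(s * r)) ^ 2 = s ^ 2 / 2 := by rw [neg_sq, mul_pow, hr]; ring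
    rw [this]
    nlinarith [sq_nonneg s]
  refine le_of_forall_pos_le_add fun ε hε => ?_
  have hcont : Filter.Tendsto (fun e : ℝ => Real.exp (s * e + (s ^ 2 / 4 +
      s * (1 - r) * affSup T 0 x))) (nhdsWithin 0 (Set.Ioi 0))
      (nhds (Real.exp (s * 0 + (s ^ 2 / 4 + s * (1 - r) * affSup T 0 x)))) :=
    ((by fun_prop : Continuous fun e : ℝ => Real.exp (s * e + (s ^ 2 / 4 +
      s * (1 - r) * affSup T 0 x))).tendsto 0).mono_left nhdsWithin_le_nhds
  have h5 := ge_of_tendsto hcont (eventually_nhdsWithin_of_forall fun e he => key e he)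
  simp only [mul_zero, zero_add] at h5
  linarith

end AffSup

/-! ### Exponential moments of the support function. -/

section Concentration

variable {E : Type*} [NormedAddCommGroup E] [InnerProductSpace ℝ E] [FiniteDimensional ℝ E]
  [MeasurableSpace E] [BorelSpace E] {T : Set E}

lemma map_rotation_prod_stdGaussian :
    ((stdGaussian E).prod (stdGaussian E)).map
      (fun p => ((√2 / 2) • p.1 + (√2 / 2) • p.2, (√2 / 2) • p.2 - (√2 / 2) • p.1))
      = (stdGaussian E).prod (stdGaussian E) := by
  have h := IsGaussian.map_rotation_eq_self (μ := stdGaussian E) (by simp) (Real.pi / 4)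
  refine Eq.trans ?_ h
  congr 1
  ext p
  · simp [ContinuousLinearMap.rotation_apply]
  · simp [ContinuousLinearMap.rotation_apply, sub_eq_add_neg, add_comm]

/-- A crude form of Gaussian concentration for the support function of a subset of the unit
ball. -/
theorem integral_exp_affSup_zero_le [Nonempty T] (hT : ∀ x ∈ T, ‖x‖ ≤ 1) {s : ℝ} (hs : 0 ≤ s) :
    ∫ g, Real.exp (s * affSup T 0 g) ∂stdGaussian E
      ≤ Real.exp (3 * (s ^ 2 + s * ∫ g, affSup T 0 g ∂stdGaussian E)) := by
  set γ := stdGaussian E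
  set r : ℝ := √2 / 2 with hr
  set w := ∫ g, affSup T 0 g ∂γ with hw
  have hw0 : 0 ≤ w := integral_affSup_zero_nonneg hT
  have h2 : √2 ^ 2 = 2 := Real.sq_sqrt (by norm_num)
  have hr2 : r ^ 2 = 1 / 2 := by rw [hr, div_pow, h2]; norm_num
  have hr0 : 0 ≤ r := by positivity
  have hr1 : r < 1 := by nlinarith
  have hrl : 1 / 2 < r := by nlinarith
  set S := affSup T (0 : T → ℝ) with hS
  have hSc : Continuous S := (lipschitzWith_affSup hT bddAbove_range_zero).continuous
  have hSn : ∀ g, |S g| ≤ ‖g‖ := abs_affSup_zero_le hT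
  have hint := fun c : ℝ => integrable_exp_mul_affSup_zero (E := E) hT c
  set e := ∫ g, Real.exp (s * S g) ∂γ with he
  have he0 : 0 < e := integral_exp_pos (hint s)
  -- comparison with an independent copy
  have hneg : Real.exp (-s * w) ≤ ∫ g, Real.exp (-s * S g) ∂γ := by
    have := convexOn_exp.map_integral_le (μ := γ) (f := fun g => -s * S g)
      Real.continuous_exp.continuousOn isClosed_univ (by simp)
      ((integrable_affSup_id hT bddAbove_range_zero).const_mul _) (hint (-s))
    rwa [integral_const_mul] at this
  have hprod : ∫ p : E × E, Real.exp (s * (S p.1 - S p.2)) ∂(γ.prod γ)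
      = e * ∫ g, Real.exp (-s * S g) ∂γ := by
    rw [he, ← integral_prod_mul]
    congr 1 with p
    rw [← Real.exp_add]
    ring_nf
  -- passing through the midpoint of the rotation
  let F : E × E → ℝ := fun p => Real.exp (2 * s * (S p.1 - S (r • p.1 + r • p.2)))
  let R : E × E → E × E := fun p => (r • p.1 + r • p.2, r • p.2 - r • p.1)
  have hFint : Integrable F (γ.prod γ) := by
    have := (integrable_exp_mul_norm_stdGaussian (E := E) (4 * s)).mul_prod
      (integrable_exp_mul_norm_stdGaussian (E := E) (2 * s))
    refine this.mono' (by fun_prop) (Filter.Eventually.of_forall fun p => ?_)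
    rw [Real.norm_of_nonneg (Real.exp_nonneg _), ← Real.exp_add]
    refine Real.exp_le_exp.2 ?_
    have h3 := (le_abs_self _).trans (hSn p.1)
    have h4 := (neg_le_abs _).trans (hSn (r • p.1 + r • p.2))
    have h5 := norm_add_le (r • p.1) (r • p.2)
    rw [norm_smul, norm_smul, Real.norm_of_nonneg hr0] at h5
    nlinarith [norm_nonneg p.1, norm_nonneg p.2, mul_nonneg hs (norm_nonneg p.1),
      mul_nonneg hs (norm_nonneg p.2)]
  have hRm : MeasurePreserving R (γ.prod γ) (γ.prod γ) :=
    ⟨by fun_prop, map_rotation_prod_stdGaussian⟩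
  have hFR : Integrable (F ∘ R) (γ.prod γ) := hRm.integrable_comp_of_integrable hFint
  have hFRi : ∫ p, F (R p) ∂(γ.prod γ) = ∫ p, F p ∂(γ.prod γ) := by
    rw [← integral_map hRm.measurable.aemeasurable
      (by rw [hRm.map_eq]; exact hFint.aestronglyMeasurable), hRm.map_eq]
  -- The difference is telescoped through the midpoint r p₁ + r p₂, and exp(a + b) ≤ (exp 2a + exp
  -- 2b)/2. A second rotation by 45 degrees carries the midpoint to p₂, so the two halves are F and
  -- F ∘ R, with equal integrals.
  have hpt : ∀ p : E × E, Real.exp (s * (S p.1 - S p.2)) ≤ 1 / 2 * F p + 1 / 2 * F (R p) := by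
    intro p
    have h6 : r • (r • p.1 + r • p.2) + r • (r • p.2 - r • p.1) = p.2 := by
      have : r • (r • p.1 + r • p.2) + r • (r • p.2 - r • p.1) = (2 * r ^ 2) • p.2 := by module
      rw [this, hr2]; norm_num
    have h7 : F (R p) = Real.exp (2 * s * (S (r • p.1 + r • p.2) - S p.2)) := by
      simp only [F, R, h6]
    have h8 : F p = Real.exp (s * (S p.1 - S (r • p.1 + r • p.2))) ^ 2 := by
      rw [← Real.exp_nat_mul]; simp only [F]; push_cast; ring_nf
    have h9 : F (R p) = Real.exp (s * (S (r • p.1 + r • p.2) - S p.2)) ^ 2 := by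
      rw [h7, ← Real.exp_nat_mul]; push_cast; ring_nf
    have h10 : Real.exp (s * (S p.1 - S p.2)) = Real.exp (s * (S p.1 - S (r • p.1 + r • p.2)))
        * Real.exp (s * (S (r • p.1 + r • p.2) - S p.2)) := by
      rw [← Real.exp_add]; ring_nf
    rw [h8, h9, h10]
    nlinarith [sq_nonneg (Real.exp (s * (S p.1 - S (r • p.1 + r • p.2)))
      - Real.exp (s * (S (r • p.1 + r • p.2) - S p.2)))]
  have hle : ∫ p : E × E, Real.exp (s * (S p.1 - S p.2)) ∂(γ.prod γ) ≤ ∫ p, F p ∂(γ.prod γ) := by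
    refine (integral_mono_of_nonneg (Filter.Eventually.of_forall fun _ => Real.exp_nonneg _)
      ((hFint.const_mul _).add (hFR.const_mul _)) (Filter.Eventually.of_forall hpt)).trans ?_
    rw [integral_add' (hFint.const_mul _) (hFR.const_mul _), integral_const_mul, integral_const_mul]
    simp only [Function.comp_apply, hFRi]
    linarith
  have hF : ∫ p, F p ∂(γ.prod γ) ≤ Real.exp (s ^ 2) * ∫ g, Real.exp (2 * (1 - r) * (s * S g)) ∂γ := by
    rw [integral_prod _ hFint, ← integral_const_mul]
    refine integral_mono hFint.integral_prod_left ?_ fun x => ?_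
    · simp_rw [← mul_assoc]
      exact (hint _).const_mul _
    · refine (integral_exp_affSup_sub_rotation_le hT (by positivity : 0 ≤ 2 * s) hr2 hr0 x).trans ?_
      rw [← Real.exp_add]
      refine Real.exp_le_exp.2 (le_of_eq ?_)
      simp only [hS]
      ring
  -- The exponent 2(1 - r) = 2 - √2 is below 1, so Jensen for a concave power applies. The moment e
  -- returns on the right with a power below 1 and can be absorbed on the left.
  have hJ : ∫ g, Real.exp (2 * (1 - r) * (s * S g)) ∂γ ≤ e ^ (2 * (1 - r)) := by
    have h11 := (Real.concaveOn_rpow (p := 2 * (1 - r)) (by linarith) (by linarith)).le_map_integral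
      (μ := γ) (f := fun g => Real.exp (s * S g))
      (Real.continuous_rpow_const (by linarith)).continuousOn isClosed_Ici
      (Filter.Eventually.of_forall fun _ => Real.exp_nonneg _) (hint s) ?_
    · refine le_trans (le_of_eq ?_) h11
      congr 1 with g
      simp only [hS]
      rw [← Real.exp_mul]
      ring_nf
    · refine (hint (s * (2 * (1 - r)))).congr (Filter.Eventually.of_forall fun g => ?_)
      simp only [Function.comp_apply, hS]
      rw [← Real.exp_mul]
      ring_nf
  have hfin : e * Real.exp (-s * w) ≤ Real.exp (s ^ 2) * e ^ (2 * (1 - r)) := by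
    calc _ ≤ e * ∫ g, Real.exp (-s * S g) ∂γ := by gcongr
      _ ≤ Real.exp (s ^ 2) * ∫ g, Real.exp (2 * (1 - r) * (s * S g)) ∂γ := by
        rw [← hprod]; exact hle.trans hF
      _ ≤ Real.exp (s ^ 2) * e ^ (2 * (1 - r)) := by gcongr
  have hlog := Real.log_le_log (by positivity) hfin
  rw [Real.log_mul he0.ne' (Real.exp_ne_zero _), Real.log_mul (Real.exp_ne_zero _)
    (by positivity), Real.log_exp, Real.log_exp, Real.log_rpow he0] at hlog
  rw [← Real.log_le_iff_le_exp he0]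
  have hX : 0 ≤ s ^ 2 + s * w := by positivity
  have h12 : (2 * r - 1) * Real.log e ≤ s ^ 2 + s * w := by linarith
  -- The surviving power of e is 2r - 1 = √2 - 1 ≥ 1/3; this is the origin of the constant 3.
  have h13 : 1 ≤ 3 * (2 * r - 1) := by nlinarith
  by_contra hcon
  push Not at hcon
  nlinarith

end Concentration

/-! ### Exponential moments of the squared norm. -/

section ChiSquare

lemma lintegral_exp_sq_gaussianReal :
    ∫⁻ x, ENNReal.ofReal (Real.exp (x ^ 2 / 4)) ∂gaussianReal 0 1 = ENNReal.ofReal √2 := by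
  rw [gaussianReal_of_var_ne_zero 0 one_ne_zero,
    lintegral_withDensity_eq_lintegral_mul _ (measurable_gaussianPDF 0 1) (by fun_prop)]
  have h : ∀ x : ℝ, (gaussianPDF 0 1 * fun x => ENNReal.ofReal (Real.exp (x ^ 2 / 4))) x
      = ENNReal.ofReal ((√(2 * Real.pi))⁻¹ * Real.exp (-(1 / 4) * x ^ 2)) := by
    intro x
    rw [Pi.mul_apply, gaussianPDF_def, ← ENNReal.ofReal_mul (gaussianPDFReal_nonneg _ _ _),
      gaussianPDFReal_def]
    simp only [NNReal.coe_one, mul_one, sub_zero]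
    rw [mul_assoc, ← Real.exp_add]
    congr 3
    ring
  simp_rw [h]
  rw [← ofReal_integral_eq_lintegral_ofReal
    ((integrable_exp_neg_mul_sq (by norm_num)).const_mul _)
    (Filter.Eventually.of_forall fun x => by positivity), integral_const_mul, integral_gaussian]
  congr 1
  rw [← Real.sqrt_inv, ← Real.sqrt_mul (by positivity)]
  congr 1
  field_simp
  norm_num

lemma lintegral_exp_norm_sq_stdGaussian (m : ℕ) :
    ∫⁻ c, ENNReal.ofReal (Real.exp (‖c‖ ^ 2 / 4)) ∂stdGaussian (EuclideanSpace ℝ (Fin m))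
      = ENNReal.ofReal √2 ^ m := by
  rw [← map_pi_eq_stdGaussian, lintegral_map (by fun_prop) (by fun_prop)]
  have h : ∀ c : Fin m → ℝ, ENNReal.ofReal (Real.exp (‖WithLp.toLp 2 c‖ ^ 2 / 4))
      = ∏ i, ENNReal.ofReal (Real.exp (c i ^ 2 / 4)) := by
    intro c
    rw [← ENNReal.ofReal_prod_of_nonneg fun _ _ => Real.exp_nonneg _, ← Real.exp_sum,
      EuclideanSpace.real_norm_sq_eq, Finset.sum_div]
  simp_rw [h]
  rw [lintegral_prod_eq_prod_lintegral_of_indepFun Finset.univ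
    (fun i (c : Fin m → ℝ) => ENNReal.ofReal (Real.exp (c i ^ 2 / 4)))
    (iIndepFun_pi (X := fun _ x => ENNReal.ofReal (Real.exp (x ^ 2 / 4)))
      (fun _ => by fun_prop)) (fun _ => by fun_prop)]
  simp_rw [← lintegral_exp_sq_gaussianReal]
  rw [Finset.prod_congr rfl fun i _ => (measurePreserving_eval
    (fun _ : Fin m => gaussianReal 0 1) i).lintegral_comp
    (f := fun x => ENNReal.ofReal (Real.exp (x ^ 2 / 4))) (by fun_prop)]
  simp

end ChiSquare

/-! ### Uniform upper bound for the quadratic form of the sample. -/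

section QuadraticUpper

variable {E : Type*} [NormedAddCommGroup E] [InnerProductSpace ℝ E] [FiniteDimensional ℝ E]
  [MeasurableSpace E] [BorelSpace E] {T : Set E}

/-- Concentration gives the exponent 3(ρ²/18 + sρw), and Young's inequality splits the mixed term.
The choice s² = 1/18 makes the coefficient of ρ² equal to 1/4, below the value 1/2 at which
exponential moments of a squared Gaussian norm cease to exist. -/
lemma lintegral_exp_affSup_zero_smul_le [Nonempty T] (hT : ∀ x ∈ T, ‖x‖ ≤ 1) {s ρ : ℝ}
    (hs : s ^ 2 = 1 / 18) (hs0 : 0 ≤ s) (hρ : 0 ≤ ρ) :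
    ∫⁻ g, ENNReal.ofReal (Real.exp (s * affSup T 0 (ρ • g))) ∂stdGaussian E ≤
      ENNReal.ofReal (Real.exp (3 / 2 * (∫ g, affSup T 0 g ∂stdGaussian E) ^ 2)) *
        ENNReal.ofReal (Real.exp (ρ ^ 2 / 4)) := by
  set w := ∫ g, affSup T 0 g ∂stdGaussian E
  simp_rw [affSup_zero_smul hρ, ← mul_assoc]
  rw [← ofReal_integral_eq_lintegral_ofReal (integrable_exp_mul_affSup_zero hT _)
    (Filter.Eventually.of_forall fun x => Real.exp_nonneg _),
    ← ENNReal.ofReal_mul (Real.exp_nonneg _), ← Real.exp_add]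
  refine ENNReal.ofReal_le_ofReal ((integral_exp_affSup_zero_le hT (by positivity)).trans
    (Real.exp_le_exp.2 ?_))
  have : 2 * (s * ρ * w) ≤ ρ ^ 2 / 18 + w ^ 2 := by
    have := sq_nonneg (s * ρ - w)
    nlinarith
  rw [mul_pow, hs]
  linarith

/-- With overwhelming probability, the quadratic form `x ↦ ∑ᵢ ⟨bᵢ, x⟩²` of a Gaussian sample is at
most of order `m` on a subset of the unit ball of small Gaussian width. -/
theorem exists_measurableSet_sum_inner_sq_le [Nonempty T] (hT : ∀ x ∈ T, ‖x‖ ≤ 1) {m : ℕ}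
    (hm : 2 * (∫ g, affSup T 0 g ∂stdGaussian E) ^ 2 ≤ m) :
    ∃ W : Set (Fin m → E), MeasurableSet W ∧
      (Measure.pi fun _ => stdGaussian E) W ≤ ENNReal.ofReal (Real.exp (-m)) ∧
      ∀ b ∉ W, ∀ x ∈ T, ∑ i, inner ℝ (b i) x ^ 2 ≤ 100 * m := by
  set w := ∫ g, affSup T 0 g ∂stdGaussian E
  set s : ℝ := √(1 / 18)
  have hs : s ^ 2 = 1 / 18 := Real.sq_sqrt (by norm_num)
  have hs0 : 0 ≤ s := Real.sqrt_nonneg _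
  have hSc : Continuous (affSup T (0 : T → ℝ)) :=
    (lipschitzWith_affSup hT bddAbove_range_zero).continuous
  -- Linearization: for u = (⟨bᵢ, x⟩)ᵢ, averaging exp(s⟨c, u⟩) over a Gaussian c gives exp(‖u‖²/36).
  -- Taking the supremum over x inside the average yields H, which dominates this for every x ∈ T.
  -- Conversely, for fixed c the sum ∑ cᵢ bᵢ is distributed as ‖c‖ g.
  let H : (Fin m → E) → ℝ≥0∞ := fun b => ∫⁻ c, ENNReal.ofReal
    (Real.exp (s * affSup T 0 (∑ i, c i • b i))) ∂stdGaussian (EuclideanSpace ℝ (Fin m))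
  have hmeas : Measurable fun p : (Fin m → E) × EuclideanSpace ℝ (Fin m) =>
      ENNReal.ofReal (Real.exp (s * affSup T 0 (∑ i, p.2 i • p.1 i))) := by fun_prop
  have hH : Measurable H := hmeas.lintegral_prod_right'
  have hHi : ∫⁻ b, H b ∂(Measure.pi fun _ : Fin m => stdGaussian E)
      ≤ ENNReal.ofReal (Real.exp (5 / 4 * m)) := by
    simp only [H]
    rw [lintegral_lintegral_swap hmeas.aemeasurable]
    have h1 : ∀ c : EuclideanSpace ℝ (Fin m), ∫⁻ b, ENNReal.ofReal
        (Real.exp (s * affSup T 0 (∑ i, c i • b i))) ∂(Measure.pi fun _ : Fin m => stdGaussian E)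
        ≤ ENNReal.ofReal (Real.exp (3 / 2 * w ^ 2)) * ENNReal.ofReal (Real.exp (‖c‖ ^ 2 / 4)) := by
      intro c
      have h2 := map_sum_smul_pi_stdGaussian (E := E) (fun i => c i)
      rw [← EuclideanSpace.real_norm_sq_eq, Real.sqrt_sq (norm_nonneg c)] at h2
      have h3 : ∀ μ : Measure (Fin m → E), ∫⁻ b, ENNReal.ofReal
          (Real.exp (s * affSup T 0 (∑ i, c i • b i))) ∂μ = ∫⁻ g, ENNReal.ofReal
          (Real.exp (s * affSup T 0 g)) ∂(μ.map fun b => ∑ i, c i • b i) := fun μ => by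
        rw [lintegral_map (by fun_prop) (by fun_prop)]
      rw [h3, h2, lintegral_map (by fun_prop) (by fun_prop)]
      exact lintegral_exp_affSup_zero_smul_le hT hs hs0 (norm_nonneg c)
    refine (lintegral_mono h1).trans ?_
    rw [lintegral_const_mul _ (by fun_prop), lintegral_exp_norm_sq_stdGaussian,
      ← ENNReal.ofReal_pow (Real.sqrt_nonneg _), ← ENNReal.ofReal_mul (Real.exp_nonneg _)]
    refine ENNReal.ofReal_le_ofReal ?_
    have h4 : √2 ≤ Real.exp (1 / 2) := by
      rw [Real.sqrt_le_left (Real.exp_nonneg _), ← Real.exp_nat_mul]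
      have := Real.add_one_le_exp (1 : ℝ)
      norm_num at this ⊢
      linarith
    calc Real.exp (3 / 2 * w ^ 2) * √2 ^ m ≤ Real.exp (3 / 2 * w ^ 2) * Real.exp (1 / 2) ^ m := by
          gcongr
      _ ≤ Real.exp (5 / 4 * m) := by
          rw [← Real.exp_nat_mul, ← Real.exp_add]
          refine Real.exp_le_exp.2 ?_
          linarith
  have hlow : ∀ b, ∀ x ∈ T, ENNReal.ofReal (Real.exp ((∑ i, inner ℝ (b i) x ^ 2) / 36)) ≤ H b := by
    intro b x hx
    let u : EuclideanSpace ℝ (Fin m) := WithLp.toLp 2 fun i => inner ℝ (b i) x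
    have hu : ‖u‖ ^ 2 = ∑ i, inner ℝ (b i) x ^ 2 := EuclideanSpace.real_norm_sq_eq u
    have h5 := integral_exp_mul_inner_stdGaussian s u
    have h6 : s ^ 2 * ‖u‖ ^ 2 / 2 = (∑ i, inner ℝ (b i) x ^ 2) / 36 := by rw [hs, hu]; ring
    rw [← h6, ← h5, ofReal_integral_eq_lintegral_ofReal ?_
      (Filter.Eventually.of_forall fun x => Real.exp_nonneg _)]
    · refine lintegral_mono fun c => ENNReal.ofReal_le_ofReal (Real.exp_le_exp.2 ?_)
      have h7 := le_affSup hT bddAbove_range_zero (∑ i, c i • b i) ⟨x, hx⟩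
      simp only [Pi.zero_apply, zero_add, sum_inner, real_inner_smul_left] at h7
      gcongr
      refine le_trans (le_of_eq ?_) h7
      rw [PiLp.inner_apply]
      simp [u, mul_comm]
    · by_contra hcon
      rw [integral_undef hcon] at h5
      exact (Real.exp_pos _).ne h5
  -- Markov at level exp(9m/4) against the mean exp(5m/4) loses exp(-m). Below that level, ∑ ⟨bᵢ,
  -- x⟩² < 36 · 9m/4 = 81 m.
  refine ⟨{b | ENNReal.ofReal (Real.exp (9 / 4 * m)) ≤ H b}, measurableSet_le measurable_const hH,
    ?_, ?_⟩
  · refine (meas_ge_le_lintegral_div hH.aemeasurable (by simp [Real.exp_pos]) (by simp)).trans ?_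
    refine (ENNReal.div_le_div_right hHi _).trans ?_
    rw [← ENNReal.ofReal_div_of_pos (Real.exp_pos _), ← Real.exp_sub]
    refine ENNReal.ofReal_le_ofReal (Real.exp_le_exp.2 ?_)
    linarith
  · intro b hb x hx
    simp only [Set.mem_ofPred_eq, not_le] at hb
    have h8 := (hlow b x hx).trans_lt hb
    rw [ENNReal.ofReal_lt_ofReal_iff (Real.exp_pos _), Real.exp_lt_exp] at h8
    have : (0 : ℝ) ≤ m := Nat.cast_nonneg m
    linarith

end QuadraticUpper

/-! ### Symmetrization and contraction for a single Gaussian sample. -/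

section Contraction

variable {E : Type*} [NormedAddCommGroup E] [InnerProductSpace ℝ E] {T : Set E} {A : T → ℝ}

/-- T may be uncountable, so measurability of the suprema and of their partial integrals is obtained
from joint continuity. -/
lemma lipschitzWith_affSup_prod {X : Type*} [PseudoMetricSpace X] [Nonempty T]
    (hT : ∀ x ∈ T, ‖x‖ ≤ 1) {B : X → T → ℝ} (hB : ∀ p, BddAbove (Set.range (B p))) {κ : NNReal}
    (hBL : ∀ p p' x, B p x ≤ B p' x + κ * dist p p') :
    LipschitzWith (κ + 1) fun p : X × E => affSup T (B p.1) p.2 := by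
  refine LipschitzWith.of_le_add_mul _ fun p p' => ?_
  refine (affSup_le_add hT (hB p'.1) (hBL p.1 p'.1) (g := p.2) (g' := p'.2)).trans ?_
  rw [← dist_eq_norm, NNReal.coe_add, NNReal.coe_one, add_mul, one_mul]
  have h1 : dist p.1 p'.1 ≤ dist p p' := le_max_left _ _
  have h2 : dist p.2 p'.2 ≤ dist p p' := le_max_right _ _
  gcongr

variable {φ : ℝ → ℝ}

lemma bddAbove_add_sum_sub (hA : BddAbove (Set.range A)) (hφ0 : ∀ u, 0 ≤ φ u) (α : ℝ)
    {ι : Type*} [Fintype ι] (b : ι → E) :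
    BddAbove (Set.range fun x : T => A x + ∑ i, (α - φ (inner ℝ (b i) (x : E)))) := by
  obtain ⟨a, ha⟩ := hA
  refine ⟨a + ∑ _i : ι, α, ?_⟩
  rintro _ ⟨x, rfl⟩
  have h1 := ha ⟨x, rfl⟩
  dsimp only
  gcongr with i
  linarith [hφ0 (inner ℝ (b i) (x : E))]

lemma bddAbove_add_sub (hA : BddAbove (Set.range A)) (hφ0 : ∀ u, 0 ≤ φ u) (α : ℝ) (b : E) :
    BddAbove (Set.range fun x : T => A x + (α - φ (inner ℝ b (x : E)))) := by
  simpa using bddAbove_add_sum_sub hA hφ0 α (fun _ : Fin 1 => b)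

lemma comp_inner_le (hT : ∀ x ∈ T, ‖x‖ ≤ 1) (hφ : LipschitzWith 1 φ) (b b' : E) (x : T) :
    φ (inner ℝ b (x : E)) ≤ φ (inner ℝ b' (x : E)) + ‖b - b'‖ := by
  have h1 := hφ.dist_le_mul (inner ℝ b (x : E)) (inner ℝ b' (x : E))
  rw [Real.dist_eq, Real.dist_eq, NNReal.coe_one, one_mul, ← inner_sub_left] at h1
  have h2 := abs_real_inner_le_norm (b - b') (x : E)
  have h3 := mul_le_of_le_one_right (norm_nonneg (b - b')) (hT x x.2)
  linarith [le_abs_self (φ (inner ℝ b (x : E)) - φ (inner ℝ b' (x : E)))]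

lemma lipschitzWith_affSup_comp [Nonempty T] (hT : ∀ x ∈ T, ‖x‖ ≤ 1) (hA : BddAbove (Set.range A))
    (hφ : LipschitzWith 1 φ) (hφ0 : ∀ u, 0 ≤ φ u) (α : ℝ) :
    LipschitzWith (1 + 1) fun p : E × E =>
      affSup T (fun x => A x + (α - φ (inner ℝ p.1 (x : E)))) p.2 := by
  refine lipschitzWith_affSup_prod (B := fun b x => A x + (α - φ (inner ℝ b (x : E)))) hT
    (fun b => bddAbove_add_sub hA hφ0 α b) fun b b' x => ?_
  have := comp_inner_le hT hφ b' b x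
  rw [NNReal.coe_one, one_mul, dist_comm, dist_eq_norm]
  linarith

lemma continuous_affSup_sum_comp [Nonempty T] (hT : ∀ x ∈ T, ‖x‖ ≤ 1)
    (hA : BddAbove (Set.range A)) (hφ : LipschitzWith 1 φ) (hφ0 : ∀ u, 0 ≤ φ u) (α : ℝ)
    {ι : Type*} [Fintype ι] (v : E) :
    Continuous fun b : ι → E =>
      affSup T (fun x => A x + ∑ i, (α - φ (inner ℝ (b i) (x : E)))) v := by
  have h := lipschitzWith_affSup_prod (E := E) (X := ι → E)
    (B := fun b x => A x + ∑ i, (α - φ (inner ℝ (b i) (x : E)))) hT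
    (fun b => bddAbove_add_sum_sub hA hφ0 α b) (κ := Fintype.card ι) fun b b' x => ?_
  · exact h.continuous.comp (by fun_prop : Continuous fun b : ι → E => (b, v))
  · have : ∑ i, (α - φ (inner ℝ (b i) (x : E))) ≤
        ∑ i, ((α - φ (inner ℝ (b' i) (x : E))) + dist b b') := by
      refine Finset.sum_le_sum fun i _ => ?_
      have h1 := comp_inner_le hT hφ (b' i) (b i) x
      have h2 := dist_le_pi_dist b b' i
      rw [dist_comm, dist_eq_norm] at h2
      linarith
    rw [Finset.sum_add_distrib] at this
    simp only [Finset.sum_const, Finset.card_univ, nsmul_eq_mul] at this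
    simp only [NNReal.coe_natCast]
    linarith

variable [FiniteDimensional ℝ E] [MeasurableSpace E] [BorelSpace E]

/-- One step of symmetrization and contraction for Gaussian samples. -/
lemma integral_affSup_sub_comp_le [Nonempty T] (hT : ∀ x ∈ T, ‖x‖ ≤ 1)
    (hA : BddAbove (Set.range A)) (hφ : LipschitzWith 1 φ) (hφ0 : ∀ u, 0 ≤ φ u)
    (hφ1 : ∀ u, φ u ≤ 1) {α : ℝ} (hα : ∀ x ∈ T, ∫ b, φ (inner ℝ b x) ∂stdGaussian E = α) (v : E) :
    ∫ b, affSup T (fun x => A x + (α - φ (inner ℝ b (x : E)))) v ∂stdGaussian E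
      ≤ ∫ b, affSup T A (v + (2 : ℝ) • b) ∂stdGaussian E := by
  set γ := stdGaussian E
  have hφc := hφ.continuous
  have hbdd : ∀ c : ℝ, ∀ b : E, BddAbove (Set.range fun x : T =>
      A x + c * φ (inner ℝ b (x : E))) := by
    intro c b
    obtain ⟨a, ha⟩ := hA
    refine ⟨a + |c|, ?_⟩
    rintro _ ⟨x, rfl⟩
    have h1 := ha ⟨x, rfl⟩
    have h2 : c * φ (inner ℝ b (x : E)) ≤ |c| * 1 := by
      have := hφ0 (inner ℝ b (x : E))
      have := hφ1 (inner ℝ b (x : E))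
      gcongr
      exact le_abs_self c
    dsimp only
    linarith
  let Q : ℝ → E → ℝ := fun c b => affSup T (fun x => A x + c * φ (inner ℝ b (x : E))) v
  have hQL : ∀ c, LipschitzWith (Real.nnabs c + 1) fun p : E × E =>
      affSup T (fun x => A x + c * φ (inner ℝ p.1 (x : E))) p.2 := by
    intro c
    refine lipschitzWith_affSup_prod (B := fun b x => A x + c * φ (inner ℝ b (x : E))) hT
      (fun b => hbdd c b) fun b b' x => ?_
    have h1 := comp_inner_le hT hφ b' b x
    have h2 := comp_inner_le hT hφ b b' x
    rw [norm_sub_rev] at h1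
    rw [Real.coe_nnabs, dist_eq_norm]
    have h3 : c * φ (inner ℝ b (x : E)) - c * φ (inner ℝ b' (x : E)) ≤ |c| * ‖b - b'‖ := by
      rw [← mul_sub]
      refine (le_abs_self _).trans ?_
      rw [abs_mul]
      gcongr
      rw [abs_le]
      constructor <;> linarith
    linarith
  have hQc : ∀ c, Continuous (Q c) := fun c =>
    (hQL c).continuous.comp (by fun_prop : Continuous fun b : E => (b, v))
  have hQb : ∀ c b, |Q c b| ≤ |affSup T A v| + |c| := by
    intro c b
    have hle : ∀ x, c * φ (inner ℝ b (x : E)) ≤ |c| ∧ -|c| ≤ c * φ (inner ℝ b (x : E)) := by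
      intro x
      have h := abs_mul c (φ (inner ℝ b (x : E)))
      have h1 : |φ (inner ℝ b (x : E))| ≤ 1 := by
        rw [abs_of_nonneg (hφ0 _)]; exact hφ1 _
      have h2 := mul_le_of_le_one_right (abs_nonneg c) h1
      rw [← h, abs_le] at h2
      exact ⟨h2.2, h2.1⟩
    have h1 : Q c b ≤ affSup T A v + (|c| + ‖v - v‖) :=
      affSup_le_add hT hA fun x => by linarith [(hle x).1]
    have h2 : affSup T A v ≤ Q c b + (|c| + ‖v - v‖) :=
      affSup_le_add hT (hbdd c b) fun x => by linarith [(hle x).2]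
    simp only [sub_self, norm_zero, add_zero] at h1 h2
    rw [abs_le]
    have h3 := le_abs_self (affSup T A v)
    have h4 := neg_abs_le (affSup T A v)
    constructor <;> linarith
  have hQi : ∀ c, Integrable (Q c) γ := fun c =>
    (integrable_const (|affSup T A v| + |c|)).mono' (hQc c).aestronglyMeasurable
      (Filter.Eventually.of_forall (hQb c))
  have hφi : ∀ x : E, Integrable (fun b => φ (inner ℝ b x)) γ := fun x =>
    (integrable_const (1 : ℝ)).mono' (by fun_prop) (Filter.Eventually.of_forall fun b => by
      rw [Real.norm_of_nonneg (hφ0 _)]; exact hφ1 _)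
  -- symmetrization
  have hsym : ∀ b, affSup T (fun x => A x + (α - φ (inner ℝ b (x : E)))) v
      ≤ 1 / 2 * (∫ b', Q 2 b' ∂γ) + 1 / 2 * Q (-2) b := by
    intro b
    -- The summand is the mean of A x + ⟨v, x⟩ + 2α and A x + ⟨v, x⟩ - 2φ⟨b, x⟩. In the first, α is
    -- the expectation of φ over a fresh sample, and the supremum moves inside that expectation.
    refine affSup_le fun x => ?_
    have h1 : A x + inner ℝ v (x : E) + 2 * α ≤ ∫ b', Q 2 b' ∂γ := by
      have h2 : ∫ b', (A x + inner ℝ v (x : E) + 2 * φ (inner ℝ b' (x : E))) ∂γ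
          = A x + inner ℝ v (x : E) + 2 * α := by
        rw [integral_add (integrable_const _) ((hφi x).const_mul 2), integral_const_mul, hα x x.2]
        simp
      rw [← h2]
      refine integral_mono ((integrable_const _).add ((hφi x).const_mul 2)) (hQi 2) fun b' => ?_
      have := le_affSup hT (hbdd 2 b') v x
      dsimp only [Q]
      linarith
    have h3 := le_affSup hT (hbdd (-2) b) v x
    dsimp only [Q]
    linarith
  -- contraction
  have hcon : ∀ b, Q 2 b + Q (-2) b ≤ affSup T A (v + (2 : ℝ) • b) + affSup T A (v + (-2 : ℝ) • b) := by
    intro b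
    rw [← le_sub_iff_add_le]
    refine affSup_le fun x => ?_
    rw [le_sub_comm]
    refine affSup_le fun y => ?_
    have h1 := hφ.dist_le_mul (inner ℝ b (x : E)) (inner ℝ b (y : E))
    rw [Real.dist_eq, Real.dist_eq, NNReal.coe_one, one_mul] at h1
    have h2 := le_affSup hT hA (v + (2 : ℝ) • b) x
    have h3 := le_affSup hT hA (v + (2 : ℝ) • b) y
    have h4 := le_affSup hT hA (v + (-2 : ℝ) • b) x
    have h5 := le_affSup hT hA (v + (-2 : ℝ) • b) y
    simp only [inner_add_left, real_inner_smul_left] at h2 h3 h4 h5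
    have h6 := le_abs_self (φ (inner ℝ b (x : E)) - φ (inner ℝ b (y : E)))
    -- By the Lipschitz property, 2φ⟨b, x⟩ - 2φ⟨b, y⟩ ≤ 2|⟨b, x - y⟩|. The sign of ⟨b, x - y⟩
    -- decides which of x, y is tested against v + 2b and which against v - 2b. Since b and -b have
    -- the same law, no further constant is lost.
    rcases abs_cases (inner ℝ b (x : E) - inner ℝ b (y : E)) with h | h <;> linarith
  have hneg : ∫ b, affSup T A (v + (-2 : ℝ) • b) ∂γ = ∫ b, affSup T A (v + (2 : ℝ) • b) ∂γ := by
    have hc := (lipschitzWith_affSup hT hA).continuous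
    conv_rhs => rw [show γ = γ.map (fun b => -b) from map_neg_stdGaussian.symm]
    rw [integral_map (by fun_prop) (by fun_prop)]
    simp
  have hi1 := integrable_affSup hT hA v 2
  have hi2 := integrable_affSup hT hA v (-2)
  have hfc : Continuous fun b => affSup T (fun x => A x + (α - φ (inner ℝ b (x : E)))) v :=
    (lipschitzWith_affSup_comp hT hA hφ hφ0 α).continuous.comp
      (by fun_prop : Continuous fun b : E => (b, v))
  have hi3 : Integrable (fun b => affSup T (fun x => A x + (α - φ (inner ℝ b (x : E)))) v) γ := by
    refine (integrable_const (|affSup T A v| + (|α| + 1))).mono' hfc.aestronglyMeasurable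
      (Filter.Eventually.of_forall fun b => ?_)
    have h1 : affSup T (fun x => A x + (α - φ (inner ℝ b (x : E)))) v
        ≤ affSup T A v + ((|α| + 1) + ‖v - v‖) :=
      affSup_le_add hT hA fun x => by linarith [hφ0 (inner ℝ b (x : E)), le_abs_self α]
    have h2 : affSup T A v ≤ affSup T (fun x => A x + (α - φ (inner ℝ b (x : E)))) v
        + ((|α| + 1) + ‖v - v‖) :=
      affSup_le_add hT (bddAbove_add_sub hA hφ0 α b) fun x => by
        linarith [hφ1 (inner ℝ b (x : E)), neg_abs_le α]
    simp only [sub_self, norm_zero, add_zero] at h1 h2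
    rw [Real.norm_eq_abs, abs_le]
    have h3 := le_abs_self (affSup T A v)
    have h4 := neg_abs_le (affSup T A v)
    constructor <;> linarith
  calc _ ≤ ∫ b, (1 / 2 * (∫ b', Q 2 b' ∂γ) + 1 / 2 * Q (-2) b) ∂γ :=
        integral_mono hi3 ((integrable_const _).add ((hQi _).const_mul _)) hsym
    _ = 1 / 2 * ∫ b, (Q 2 b + Q (-2) b) ∂γ := by
        rw [integral_add (integrable_const _) ((hQi _).const_mul _), integral_add (hQi _) (hQi _),
          integral_const, integral_const_mul, probReal_univ, one_smul]
        ring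
    _ ≤ 1 / 2 * ∫ b, (affSup T A (v + (2 : ℝ) • b) + affSup T A (v + (-2 : ℝ) • b)) ∂γ := by
        exact mul_le_mul_of_nonneg_left
          (integral_mono ((hQi _).add (hQi _)) (hi1.add hi2) hcon) (by norm_num)
    _ = ∫ b, affSup T A (v + (2 : ℝ) • b) ∂γ := by
        rw [integral_add hi1 hi2, hneg]
        ring

end Contraction

/-! ### Uniform lower bound for empirical means of a bounded Lipschitz function. -/

section EmpiricalProcess

variable {E : Type*} [NormedAddCommGroup E] [InnerProductSpace ℝ E] [FiniteDimensional ℝ E]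
  [MeasurableSpace E] [BorelSpace E] {T : Set E} {A : T → ℝ} {φ : ℝ → ℝ}

/-- Hoeffding's lemma for a function with oscillation at most one. -/
lemma lintegral_exp_mul_le_of_sub_le_one {X : Type*} [MeasurableSpace X] {μ : Measure X}
    [IsProbabilityMeasure μ] {J : X → ℝ} (hJ : Measurable J) (hosc : ∀ b b', J b ≤ J b' + 1)
    (s : ℝ) : ∫⁻ b, ENNReal.ofReal (Real.exp (s * J b)) ∂μ
      ≤ ENNReal.ofReal (Real.exp (s ^ 2 / 2 + s * ∫ b, J b ∂μ)) := by
  obtain ⟨b₀⟩ := nonempty_of_isProbabilityMeasure μ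
  -- The interval of radius 1 around J b₀ has length 2, hence the sub-Gaussian parameter is 1 and
  -- the exponent s²/2.
  have h := hasSubgaussianMGF_of_mem_Icc (μ := μ) (a := J b₀ - 1) (b := J b₀ + 1) hJ.aemeasurable
    (Filter.Eventually.of_forall fun b => ⟨by linarith [hosc b₀ b], hosc b b₀⟩)
  have h1 := h.mgf_le s
  have h2 : ((‖J b₀ + 1 - (J b₀ - 1)‖₊ / 2) ^ 2 : NNReal) = 1 := by
    have : J b₀ + 1 - (J b₀ - 1) = 2 := by ring
    rw [this]
    simp
  rw [h2, mgf, NNReal.coe_one, one_mul] at h1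
  have h3 : ∀ b, Real.exp (s * J b)
      = Real.exp (s * ∫ b, J b ∂μ) * Real.exp (s * (J b - ∫ b, J b ∂μ)) := by
    intro b
    rw [← Real.exp_add]
    ring_nf
  rw [← ofReal_integral_eq_lintegral_ofReal ?_
    (Filter.Eventually.of_forall fun _ => Real.exp_nonneg _)]
  · refine ENNReal.ofReal_le_ofReal ?_
    simp_rw [h3]
    rw [integral_const_mul, add_comm, Real.exp_add]
    gcongr
  · simp_rw [h3]
    exact (h.integrable_exp_mul s).const_mul _

/-- Exponential moments of the supremum of the empirical process `x ↦ ∑ᵢ (α - φ ⟨bᵢ, x⟩)` of a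
Gaussian sample, for a bounded Lipschitz function `φ`, in terms of the Gaussian width. -/
theorem lintegral_exp_affSup_sum_le [Nonempty T] (hT : ∀ x ∈ T, ‖x‖ ≤ 1)
    (hφ : LipschitzWith 1 φ) (hφ0 : ∀ u, 0 ≤ φ u)
    (hφ1 : ∀ u, φ u ≤ 1) {α : ℝ} (hα : ∀ x ∈ T, ∫ b, φ (inner ℝ b x) ∂stdGaussian E = α)
    {s : ℝ} (hs : 0 ≤ s) (m : ℕ) (A : T → ℝ) (hA : BddAbove (Set.range A)) :
    ∫⁻ b : Fin m → E, ENNReal.ofReal (Real.exp (s *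
        affSup T (fun x => A x + ∑ i, (α - φ (inner ℝ (b i) (x : E)))) 0))
        ∂(Measure.pi fun _ => stdGaussian E)
      ≤ ENNReal.ofReal (Real.exp (m * s ^ 2 / 2 +
        s * ∫ g, affSup T A ((2 * √m) • g) ∂stdGaussian E)) := by
  set γ := stdGaussian E
  -- The offset A must stay arbitrary: the split-off sample is absorbed into it before the induction
  -- hypothesis is applied to the others.
  induction m generalizing A with
  | zero => simp
  | succ m ih =>
    have hmp := (measurePreserving_piFinSuccAbove (fun _ : Fin (m + 1) => γ) 0).symm
    rw [← hmp.lintegral_comp_emb (MeasurableEquiv.measurableEmbedding _)]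
    have hcont := (continuous_affSup_sum_comp hT hA hφ hφ0 α (ι := Fin (m + 1)) 0).measurable
    have hsplit : ∀ (x : E) (b : Fin m → E),
        affSup T (fun z => A z + ∑ i, (α - φ (inner ℝ
          ((MeasurableEquiv.piFinSuccAbove (fun _ : Fin (m + 1) => E) 0).symm (x, b) i)
            (z : E)))) 0
        = affSup T (fun z => (A z + (α - φ (inner ℝ x (z : E)))) +
            ∑ i, (α - φ (inner ℝ (b i) (z : E)))) 0 := by
      intro x b
      congr 1 with z
      rw [Fin.sum_univ_succ, ← add_assoc]
      simp [MeasurableEquiv.piFinSuccAbove]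
    have hmeas := ((hcont.comp (MeasurableEquiv.measurable
      (MeasurableEquiv.piFinSuccAbove (fun _ : Fin (m + 1) => E) 0).symm)).const_mul
      s).exp.ennreal_ofReal
    simp only [Function.comp_def] at hmeas
    rw [lintegral_prod _ hmeas.aemeasurable]
    simp_rw [hsplit]
    -- J is the width appearing in the induction hypothesis, as a function of the split-off sample.
    -- Since φ takes values in [0, 1], J oscillates by at most 1, and Hoeffding's lemma supplies the
    -- increment s²/2.
    let J : E → ℝ := fun x => ∫ g, affSup T (fun z => A z + (α - φ (inner ℝ x (z : E))))
      ((2 * √m) • g) ∂γ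
    have hLip := lipschitzWith_affSup_comp hT hA hφ hφ0 α
    have hi : ∀ x, Integrable (fun g => affSup T (fun z => A z + (α - φ (inner ℝ x (z : E))))
        ((2 * √m) • g)) γ := fun x => integrable_affSup_smul hT (bddAbove_add_sub hA hφ0 α x) _
    have hJm : Measurable J := by
      have hc : Continuous fun p : E × E => affSup T (fun z => A z + (α - φ (inner ℝ p.1 (z : E))))
        ((2 * √m) • p.2) := hLip.continuous.comp
          (by fun_prop : Continuous fun p : E × E => (p.1, (2 * √m) • p.2))
      exact hc.stronglyMeasurable.integral_prod_right'.measurable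
    have hosc : ∀ b b', J b ≤ J b' + 1 := by
      intro b b'
      have : J b' + 1 = ∫ g, (affSup T (fun z => A z + (α - φ (inner ℝ b' (z : E))))
          ((2 * √m) • g) + 1) ∂γ := by
        rw [integral_add (hi b') (integrable_const _)]
        simp [J]
      rw [this]
      refine integral_mono (hi b) ((hi b').add (integrable_const _)) fun g => ?_
      have := affSup_le_add (A := fun z => A z + (α - φ (inner ℝ b (z : E)))) hT
        (bddAbove_add_sub hA hφ0 α b') (g := (2 * √m) • g) (g' := (2 * √m) • g)
        (c := 1) (fun z => by linarith [hφ0 (inner ℝ b (z : E)), hφ1 (inner ℝ b' (z : E))])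
      simpa using this
    -- Contraction replaces the split-off sample by an independent Gaussian 2b. Added to 2√m g it
    -- gives variance 4m + 4 = (2√(m+1))², so the bound closes without accumulating constants.
    have hJint : ∫ x, J x ∂γ ≤ ∫ g, affSup T A ((2 * √(m + 1 : ℕ)) • g) ∂γ := by
      have hAc := (lipschitzWith_affSup hT hA).continuous
      have hpi : Integrable (fun p : E × E => ‖p.1‖) (γ.prod γ) :=
        integrable_norm_stdGaussian.comp_fst _
      have hpi2 : Integrable (fun p : E × E => ‖p.2‖) (γ.prod γ) :=
        integrable_norm_stdGaussian.comp_snd _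
      have hint1 : Integrable (fun p : E × E => affSup T
          (fun z => A z + (α - φ (inner ℝ p.1 (z : E)))) ((2 * √m) • p.2)) (γ.prod γ) := by
        refine ((integrable_const (|affSup T A 0| + (|α| + 1))).add
          (hpi2.const_mul (2 * √m))).mono' (hLip.continuous.comp
          (by fun_prop : Continuous fun p : E × E => (p.1, (2 * √m) • p.2))).aestronglyMeasurable
          (Filter.Eventually.of_forall fun p => ?_)
        have hn : ‖(2 * √m) • p.2‖ = 2 * √m * ‖p.2‖ := by
          rw [norm_smul, Real.norm_of_nonneg (by positivity)]
        have h1 := affSup_le_add (A := fun z => A z + (α - φ (inner ℝ p.1 (z : E)))) hT hA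
          (g := (2 * √m) • p.2) (g' := 0) (c := |α| + 1)
          (fun x => by linarith [hφ0 (inner ℝ p.1 (x : E)), le_abs_self α])
        have h2 := affSup_le_add hT (bddAbove_add_sub hA hφ0 α p.1)
          (g := 0) (g' := (2 * √m) • p.2) (A := A) (c := |α| + 1)
          (fun x => by linarith [hφ1 (inner ℝ p.1 (x : E)), neg_abs_le α])
        rw [sub_zero, hn] at h1
        rw [zero_sub, norm_neg, hn] at h2
        have h3 := le_abs_self (affSup T A 0)
        have h4 := neg_abs_le (affSup T A 0)
        simp only [Pi.add_apply]
        rw [Real.norm_eq_abs, abs_le]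
        constructor <;> linarith
      have hint2 : Integrable (fun p : E × E => affSup T A ((2 * √m) • p.1 + (2 : ℝ) • p.2))
          (γ.prod γ) := by
        refine ((integrable_const (|affSup T A 0|)).add ((hpi.const_mul (2 * √m)).add
          (hpi2.const_mul 2))).mono' (by fun_prop) (Filter.Eventually.of_forall fun p => ?_)
        have h1 := abs_affSup_le hT hA ((2 * √m) • p.1 + (2 : ℝ) • p.2)
        have h2 := norm_add_le ((2 * √m) • p.1) ((2 : ℝ) • p.2)
        rw [norm_smul, norm_smul, Real.norm_of_nonneg (by positivity), Real.norm_ofNat] at h2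
        simp only [Pi.add_apply]
        rw [Real.norm_eq_abs]
        linarith
      simp only [J]
      rw [integral_integral_swap hint1]
      have hsqrt : √((2 * √m) ^ 2 + 2 ^ 2) = 2 * √(m + 1 : ℕ) := by
        rw [mul_pow, Real.sq_sqrt (Nat.cast_nonneg m)]
        rw [show (2 : ℝ) ^ 2 * m + 2 ^ 2 = 2 ^ 2 * ((m + 1 : ℕ) : ℝ) by push_cast; ring,
          Real.sqrt_mul (by norm_num), Real.sqrt_sq (by norm_num)]
      have h5 := map_smul_add_smul_prod_stdGaussian (E := E) (2 * √m) 2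
      rw [hsqrt] at h5
      have h6 : ∫ g, affSup T A ((2 * √(m + 1 : ℕ)) • g) ∂γ
          = ∫ p : E × E, affSup T A ((2 * √m) • p.1 + (2 : ℝ) • p.2) ∂(γ.prod γ) := by
        rw [← integral_map (f := affSup T A) (φ := fun g => (2 * √(m + 1 : ℕ)) • g) (by fun_prop)
          (by fun_prop), ← h5, integral_map (by fun_prop) (by fun_prop)]
      rw [h6, integral_prod _ hint2]
      refine integral_mono hint1.integral_prod_right hint2.integral_prod_left fun g => ?_
      exact integral_affSup_sub_comp_le hT hA hφ hφ0 hφ1 hα _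
    calc _ ≤ ∫⁻ x, ENNReal.ofReal (Real.exp (m * s ^ 2 / 2 + s * J x)) ∂γ :=
          lintegral_mono fun x => ih _ (bddAbove_add_sub hA hφ0 α x)
      _ = ENNReal.ofReal (Real.exp (m * s ^ 2 / 2)) *
            ∫⁻ x, ENNReal.ofReal (Real.exp (s * J x)) ∂γ := by
          rw [← lintegral_const_mul _ (by fun_prop)]
          simp_rw [← ENNReal.ofReal_mul (Real.exp_nonneg _), ← Real.exp_add]
      _ ≤ ENNReal.ofReal (Real.exp (m * s ^ 2 / 2)) *
            ENNReal.ofReal (Real.exp (s ^ 2 / 2 + s * ∫ x, J x ∂γ)) := by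
          gcongr
          exact lintegral_exp_mul_le_of_sub_le_one hJm hosc s
      _ ≤ _ := by
          rw [← ENNReal.ofReal_mul (Real.exp_nonneg _), ← Real.exp_add]
          refine ENNReal.ofReal_le_ofReal (Real.exp_le_exp.2 ?_)
          have := mul_le_mul_of_nonneg_left hJint hs
          push_cast at this ⊢
          linarith

/-- With overwhelming probability, the empirical mean of `φ ⟨bᵢ, x⟩` is bounded below, uniformly
over a set `T` of small Gaussian width. -/
theorem exists_measurableSet_le_sum_comp_inner [Nonempty T] (hT : ∀ x ∈ T, ‖x‖ ≤ 1)
    (hφ : LipschitzWith 1 φ) (hφ0 : ∀ u, 0 ≤ φ u)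
    (hφ1 : ∀ u, φ u ≤ 1) {α : ℝ} (hα0 : 0 < α)
    (hα : ∀ x ∈ T, ∫ b, φ (inner ℝ b x) ∂stdGaussian E = α) {m : ℕ}
    (hm : 32 * ∫ g, affSup T 0 g ∂stdGaussian E ≤ α * √m) :
    ∃ W : Set (Fin m → E), MeasurableSet W ∧
      (Measure.pi fun _ => stdGaussian E) W ≤ ENNReal.ofReal (Real.exp (-(α ^ 2 / 128 * m))) ∧
      ∀ b ∉ W, ∀ x ∈ T, 3 / 4 * α * m ≤ ∑ i, φ (inner ℝ (b i) x) := by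
  set w := ∫ g, affSup T 0 g ∂stdGaussian E
  -- With s = α/8 and threshold αm/4, the exponent is α²m/128 + α√m w/4 - α²m/32. The width
  -- condition bounds the middle term by α²m/128.
  have hmain := lintegral_exp_affSup_sum_le hT hφ hφ0 hφ1 hα (s := α / 8) (by positivity) m 0
    bddAbove_range_zero
  have hw : ∫ g, affSup T 0 ((2 * √m) • g) ∂stdGaussian E = 2 * √m * w := by
    simp_rw [affSup_zero_smul (show 0 ≤ 2 * √(m : ℝ) by positivity)]
    rw [integral_const_mul]
  rw [hw] at hmain
  have hc := (continuous_affSup_sum_comp (A := 0) hT bddAbove_range_zero hφ hφ0 α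
    (ι := Fin m) 0).measurable
  refine ⟨{b | ENNReal.ofReal (Real.exp (α / 8 * (α / 4 * m))) ≤ ENNReal.ofReal (Real.exp (α / 8 *
        affSup T (fun x => (0 : T → ℝ) x + ∑ i, (α - φ (inner ℝ (b i) (x : E)))) 0))},
    measurableSet_le measurable_const (by fun_prop), ?_, ?_⟩
  · refine (meas_ge_le_lintegral_div (Measurable.aemeasurable (by fun_prop))
      (by simp [Real.exp_pos]) (by simp)).trans ?_
    refine (ENNReal.div_le_div_right hmain _).trans ?_
    rw [← ENNReal.ofReal_div_of_pos (Real.exp_pos _), ← Real.exp_sub]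
    refine ENNReal.ofReal_le_ofReal (Real.exp_le_exp.2 ?_)
    have h1 : √(m : ℝ) * √m = m := Real.mul_self_sqrt (Nat.cast_nonneg m)
    have h2 := mul_le_mul_of_nonneg_left hm (by positivity : 0 ≤ α / 128 * √m)
    have h3 : α / 128 * √m * (α * √m) = α ^ 2 / 128 * m := by
      linear_combination α ^ 2 / 128 * h1
    rw [h3] at h2
    nlinarith
  · intro b hb x hx
    simp only [Set.mem_ofPred_eq, not_le] at hb
    rw [ENNReal.ofReal_lt_ofReal_iff (Real.exp_pos _), Real.exp_lt_exp,
      mul_lt_mul_iff_right₀ (by positivity)] at hb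
    have h1 := le_affSup hT (bddAbove_add_sum_sub bddAbove_range_zero hφ0 α b) 0 ⟨x, hx⟩
    simp only [inner_zero_left, add_zero, Pi.zero_apply, zero_add, Finset.sum_sub_distrib,
      Finset.sum_const, Finset.card_univ, Fintype.card_fin, nsmul_eq_mul] at h1 hb
    linarith

end EmpiricalProcess

/-! ### Tools for the multiplier process. -/

section Multiplier

/-- Markov's inequality with a strict threshold, which keeps it valid for κ = 0: then G vanishes
almost everywhere. This covers σ = 0 and η = 0. -/
lemma measure_lt_le_of_lintegral_le {X : Type*} [MeasurableSpace X] {μ : Measure X}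
    {G : X → ℝ≥0∞} (hG : Measurable G) {κ τ : ℝ} (hτ : 0 < τ) (hκ : 0 ≤ κ)
    (h : ∫⁻ p, G p ∂μ ≤ ENNReal.ofReal κ) :
    μ {p | ENNReal.ofReal (κ / τ) < G p} ≤ ENNReal.ofReal τ := by
  rcases hκ.eq_or_lt with rfl | hκ
  · rw [ENNReal.ofReal_zero, nonpos_iff_eq_zero, lintegral_eq_zero_iff hG] at h
    have : μ {p | ENNReal.ofReal (0 / τ) < G p} = 0 := by
      simpa [Filter.EventuallyEq, ae_iff, pos_iff_ne_zero] using h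
    rw [this]
    exact zero_le
  · have hsub : {p | ENNReal.ofReal (κ / τ) < G p} ⊆ {p | ENNReal.ofReal (κ / τ) ≤ G p} :=
      Set.ofPred_subset_ofPred.2 fun p hp => hp.le
    refine (measure_mono hsub).trans
      ((meas_ge_le_lintegral_div hG.aemeasurable 
        (ENNReal.ofReal_pos.2 (by positivity)).ne' (by simp)).trans ?_)
    refine (ENNReal.div_le_div_right h _).trans ?_
    rw [← ENNReal.ofReal_div_of_pos (by positivity)]
    exact ENNReal.ofReal_le_ofReal (le_of_eq (by field_simp))

lemma lintegral_pi_comp_eval {X : Type*} [MeasurableSpace X] {μ : Measure X}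
    [IsProbabilityMeasure μ] {m : ℕ} {F : X → ℝ≥0∞} (hF : Measurable F) (i : Fin m) :
    ∫⁻ p : Fin m → X, F (p i) ∂(Measure.pi fun _ => μ) = ∫⁻ x, F x ∂μ :=
  (measurePreserving_eval (fun _ : Fin m => μ) i).lintegral_comp hF

/-- The second moment of a sum of independent centered copies. -/
lemma lintegral_sum_sq_pi {X : Type*} [MeasurableSpace X] {μ : Measure X}
    [IsProbabilityMeasure μ] {F : X → ℝ} (hF : MemLp F 2 μ) (h0 : ∫ x, F x ∂μ = 0) (m : ℕ) :
    ∫⁻ p : Fin m → X, ENNReal.ofReal ((∑ i, F (p i)) ^ 2) ∂(Measure.pi fun _ => μ)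
      = ENNReal.ofReal (m * ∫ x, F x ^ 2 ∂μ) := by
  have hv := variance_sum_pi (μ := fun _ : Fin m => μ) (X := fun _ => F) (fun _ => hF)
  have hFi : ∀ i : Fin m, MemLp (fun p : Fin m → X => F (p i)) 2 (Measure.pi fun _ => μ) :=
    fun i => hF.comp_measurePreserving (measurePreserving_eval _ i)
  have hsum : MemLp (fun p : Fin m → X => ∑ i, F (p i)) 2 (Measure.pi fun _ => μ) :=
    memLp_finsetSum _ fun i _ => hFi i
  have hmean : ∫ p : Fin m → X, ∑ i, F (p i) ∂(Measure.pi fun _ => μ) = 0 := by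
    rw [integral_finsetSum _ fun i _ => (hFi i).integrable one_le_two]
    refine Finset.sum_eq_zero fun i _ => ?_
    rw [integral_comp_eval (μ := fun _ : Fin m => μ) hF.aestronglyMeasurable, h0]
  rw [← ofReal_integral_eq_lintegral_ofReal hsum.integrable_sq
    (Filter.Eventually.of_forall fun _ => sq_nonneg _)]
  congr 1
  have h1 : Var[∑ i : Fin m, fun p : Fin m → X => F (p i); Measure.pi fun _ => μ]
      = ∫ p : Fin m → X, (∑ i, F (p i)) ^ 2 ∂(Measure.pi fun _ => μ) := by
    have : (∑ i : Fin m, fun p : Fin m → X => F (p i)) = fun p => ∑ i, F (p i) := by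
      ext p; simp
    rw [this, variance_of_integral_eq_zero hsum.aestronglyMeasurable.aemeasurable hmean]
  rw [← h1, hv, variance_of_integral_eq_zero hF.aestronglyMeasurable.aemeasurable h0]
  simp

variable {E : Type*} [NormedAddCommGroup E] [InnerProductSpace ℝ E]

/-- The orthogonal projection onto the complement of a unit vector `z`. -/
noncomputable def projOrth (z : E) : E →L[ℝ] E :=
  ContinuousLinearMap.id ℝ E - (innerSL ℝ z).smulRight z

lemma projOrth_apply (z x : E) : projOrth z x = x - inner ℝ z x • z := by
  simp [projOrth]

lemma inner_projOrth (z x y : E) : inner ℝ (projOrth z x) y = inner ℝ x (projOrth z y) := by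
  simp only [projOrth_apply, inner_sub_left, inner_sub_right, real_inner_smul_left,
    real_inner_smul_right, real_inner_comm x z]
  ring

variable [FiniteDimensional ℝ E] [MeasurableSpace E] [BorelSpace E] {T : Set E}

/-- The projection is the average of the identity and the reflection that reverses z. The support
function is convex, and the reflection preserves the Gaussian law. -/
lemma integral_affSup_projOrth_le [Nonempty T] (hT : ∀ x ∈ T, ‖x‖ ≤ 1) {z : E} (hz : ‖z‖ = 1) :
    ∫ g, affSup T 0 (projOrth z g) ∂stdGaussian E ≤ ∫ g, affSup T 0 g ∂stdGaussian E := by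
  have hc := (lipschitzWith_affSup (A := 0) hT bddAbove_range_zero).continuous
  let R : E ≃ₗᵢ[ℝ] E := (Submodule.reflection (ℝ ∙ z)).trans (LinearIsometryEquiv.neg ℝ)
  have hR : ∀ g, R g = g - (2 * inner ℝ z g) • z := by
    intro g
    simp [R, Submodule.reflection_singleton_apply, hz]
    module
  have hRmp : MeasurePreserving R (stdGaussian E) (stdGaussian E) :=
    ⟨R.continuous.measurable, stdGaussian_map R⟩
  have hi := integrable_affSup_id (A := 0) hT bddAbove_range_zero
  have hiR : Integrable (fun g => affSup T 0 (R g)) (stdGaussian E) :=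
    hRmp.integrable_comp_of_integrable hi
  have hpt : ∀ g, affSup T 0 (projOrth z g) ≤ 1 / 2 * affSup T 0 g + 1 / 2 * affSup T 0 (R g) := by
    intro g
    refine affSup_le fun x => ?_
    have h1 := le_affSup hT bddAbove_range_zero g x
    have h2 := le_affSup hT bddAbove_range_zero (R g) x
    rw [hR] at h2 ⊢
    simp only [projOrth_apply, inner_sub_left, real_inner_smul_left, Pi.zero_apply] at h1 h2 ⊢
    linarith
  have hiP : Integrable (fun g => affSup T 0 (projOrth z g)) (stdGaussian E) := by
    refine (integrable_norm_stdGaussian.const_mul ‖projOrth z‖).mono' (by fun_prop)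
      (Filter.Eventually.of_forall fun g => ?_)
    exact (abs_affSup_zero_le hT _).trans ((projOrth z).le_opNorm g)
  refine (integral_mono hiP ((hi.const_mul _).add (hiR.const_mul _)) hpt).trans (le_of_eq ?_)
  have h3 : ∫ g, affSup T 0 (R g) ∂stdGaussian E = ∫ g, affSup T 0 g ∂stdGaussian E := by
    rw [← integral_map hRmp.measurable.aemeasurable (by fun_prop), hRmp.map_eq]
  rw [integral_add' (hi.const_mul _) (hiR.const_mul _), integral_const_mul, integral_const_mul, h3]
  ring

variable {Θ : Type*} [MeasurableSpace Θ] {ν : Measure Θ} [IsProbabilityMeasure ν]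

/-- The component of a Gaussian vector orthogonal to `z` may be replaced by an independent copy. -/
lemma measurePreserving_replace_orthogonal {z : E} (hz : ‖z‖ = 1) :
    MeasurePreserving (fun q : (E × Θ) × E => (inner ℝ z q.1.1 • z + projOrth z q.2, q.1.2))
      (((stdGaussian E).prod ν).prod (stdGaussian E)) ((stdGaussian E).prod ν) := by
  refine ⟨by fun_prop, ?_⟩
  have hmp : ((stdGaussian E).prod (stdGaussian E)).map
      (fun p => ((innerSL ℝ z).smulRight z) p.1 + projOrth z p.2) = stdGaussian E := by
    refine map_add_prod_stdGaussian _ _ ((innerSL ℝ z).smulRight z) (projOrth z) (fun x y => ?_)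
      (inner_projOrth z) fun y => ?_
    · simp [real_inner_smul_left, real_inner_smul_right, real_inner_comm x z, mul_comm]
    · have h1 : ‖y - inner ℝ z y • z‖ ^ 2 = ‖y‖ ^ 2 - inner ℝ z y ^ 2 := by
        rw [norm_sub_sq_real, norm_smul, hz, real_inner_smul_right, real_inner_comm]
        simp only [Real.norm_eq_abs, mul_one, sq_abs]
        ring
      simp [projOrth_apply, norm_smul, hz, h1]
  refine Measure.ext_of_lintegral _ fun F hF => ?_
  rw [lintegral_map hF (by fun_prop), lintegral_prod _ (by fun_prop), lintegral_prod _ (by fun_prop),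
    lintegral_prod_symm' _ hF, lintegral_lintegral_swap (by fun_prop)]
  refine lintegral_congr fun θ => ?_
  conv_rhs => rw [← hmp]
  rw [lintegral_map (by fun_prop) (by fun_prop), lintegral_prod _ (by fun_prop)]
  rfl

end Multiplier

/-! ### Suprema of the multiplier process and counting of exceptional samples. -/

section MultiplierProcess

variable {E : Type*} [NormedAddCommGroup E] [InnerProductSpace ℝ E] [FiniteDimensional ℝ E]
  [MeasurableSpace E] [BorelSpace E] {T : Set E}
  {Θ : Type*} [MeasurableSpace Θ] {ν : Measure Θ} [IsProbabilityMeasure ν]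

/-- The expected supremum of the multiplier process `x ↦ -∑ᵢ F(bᵢ, θᵢ) ⟨bᵢ, x⟩`, restricted to the
directions orthogonal to `z`, where the multipliers depend on `bᵢ` only through `⟨z, bᵢ⟩`. -/
theorem lintegral_affSup_multiplier_le (hT : ∀ x ∈ T, ‖x‖ ≤ 1) (h0 : (0 : E) ∈ T) {z : E}
    (hz : ‖z‖ = 1) {F : E × Θ → ℝ} (hF : Measurable F)
    (hFz : ∀ b b' θ, F (inner ℝ z b • z + projOrth z b', θ) = F (b, θ))
    (hF2 : Integrable (fun p => F p ^ 2) ((stdGaussian E).prod ν)) {σ : ℝ} (hσ0 : 0 ≤ σ)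
    (hσ : σ ^ 2 = ∫ p, F p ^ 2 ∂((stdGaussian E).prod ν)) (m : ℕ) :
    ∫⁻ p : Fin m → E × Θ, ENNReal.ofReal
        (affSup T 0 (∑ i, (-F (p i)) • projOrth z (p i).1))
        ∂(Measure.pi fun _ => (stdGaussian E).prod ν)
      ≤ ENNReal.ofReal (√m * σ * ∫ g, affSup T 0 g ∂stdGaussian E) := by
  have : Nonempty T := ⟨⟨0, h0⟩⟩
  set w := ∫ g, affSup T 0 g ∂stdGaussian E with hw
  have hw0 : 0 ≤ w := integral_affSup_zero_nonneg hT
  have hc : Continuous (affSup T (0 : T → ℝ)) :=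
    (lipschitzWith_affSup hT bddAbove_range_zero).continuous
  have hpos : ∀ g, 0 ≤ affSup T 0 g := fun g => by
    simpa using le_affSup hT bddAbove_range_zero g ⟨0, h0⟩
  have hzz : inner ℝ z z = 1 := by rw [real_inner_self_eq_norm_sq, hz, one_pow]
  have hP : ∀ b b' : E, projOrth z (inner ℝ z b • z + projOrth z b') = projOrth z b' := by
    intro b b'
    simp only [projOrth_apply, inner_add_right, inner_sub_right, real_inner_smul_right, hzz]
    module
  -- All orthogonal components are replaced at once by those of an independent sample. The
  -- multipliers do not change, so afterwards they can be frozen.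
  have hΦ : MeasurePreserving
      (fun (q : (Fin m → E × Θ) × (Fin m → E)) i =>
        (inner ℝ z (q.1 i).1 • z + projOrth z (q.2 i), (q.1 i).2))
      ((Measure.pi fun _ => (stdGaussian E).prod ν).prod (Measure.pi fun _ => stdGaussian E))
      (Measure.pi fun _ => (stdGaussian E).prod ν) :=
    (measurePreserving_pi (fun _ : Fin m => ((stdGaussian E).prod ν).prod (stdGaussian E)) _
      fun _ => measurePreserving_replace_orthogonal hz).comp
      (measurePreserving_arrowProdEquivProdArrow (E × Θ) E (Fin m) _ _).symm
  have hG : Measurable fun p : Fin m → E × Θ => ENNReal.ofReal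
      (affSup T 0 (∑ i, (-F (p i)) • projOrth z (p i).1)) := by fun_prop
  have hG2 : Measurable fun q : (Fin m → E × Θ) × (Fin m → E) => ENNReal.ofReal
      (affSup T 0 (projOrth z (∑ i, (-F (q.1 i)) • q.2 i))) := by fun_prop
  rw [← hΦ.lintegral_comp hG]
  simp_rw [hFz, hP, Prod.mk.eta, ← map_smul, ← map_sum]
  rw [lintegral_prod _ hG2.aemeasurable]
  have hsmul : ∀ (r : ℝ) (g : E), 0 ≤ r →
      affSup T 0 (projOrth z (r • g)) = r * affSup T 0 (projOrth z g) := fun r g hr => by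
    rw [map_smul, affSup_zero_smul hr]
  have hin : ∀ p : Fin m → E × Θ, ∫⁻ b : Fin m → E, ENNReal.ofReal
      (affSup T 0 (projOrth z (∑ i, (-F (p i)) • b i))) ∂(Measure.pi fun _ => stdGaussian E)
      ≤ ENNReal.ofReal (√(∑ i, F (p i) ^ 2) * w) := by
    intro p
    have h1 := map_sum_smul_pi_stdGaussian (E := E) (fun i => -F (p i))
    have h2 : ∀ μ : Measure (Fin m → E), ∫⁻ b, ENNReal.ofReal
        (affSup T 0 (projOrth z (∑ i, (-F (p i)) • b i))) ∂μ = ∫⁻ g, ENNReal.ofReal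
        (affSup T 0 (projOrth z g)) ∂(μ.map fun b => ∑ i, (-F (p i)) • b i) := fun μ => by
      rw [lintegral_map (by fun_prop) (by fun_prop)]
    rw [h2, h1, lintegral_map (by fun_prop) (by fun_prop)]
    simp_rw [hsmul _ _ (Real.sqrt_nonneg _), ENNReal.ofReal_mul (Real.sqrt_nonneg _), neg_sq]
    rw [lintegral_const_mul _ (by fun_prop)]
    gcongr
    have hiP : Integrable (fun g => affSup T 0 (projOrth z g)) (stdGaussian E) := by
      refine (integrable_norm_stdGaussian.const_mul ‖projOrth z‖).mono' (by fun_prop)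
        (Filter.Eventually.of_forall fun g => ?_)
      exact (abs_affSup_zero_le hT _).trans ((projOrth z).le_opNorm g)
    rw [← ofReal_integral_eq_lintegral_ofReal hiP (Filter.Eventually.of_forall fun g => hpos _)]
    exact ENNReal.ofReal_le_ofReal (integral_affSup_projOrth_le hT hz)
  refine (lintegral_mono hin).trans ?_
  simp_rw [ENNReal.ofReal_mul (Real.sqrt_nonneg _)]
  rw [lintegral_mul_const _ (by fun_prop), ENNReal.ofReal_mul (by positivity)]
  gcongr
  set π := Measure.pi fun _ : Fin m => (stdGaussian E).prod ν
  have hYi : ∀ i, Integrable (fun p : Fin m → E × Θ => F (p i) ^ 2) π := fun i =>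
    (measurePreserving_eval (fun _ : Fin m => (stdGaussian E).prod ν) i).integrable_comp_of_integrable
      hF2
  have hY : Integrable (fun p : Fin m → E × Θ => ∑ i, F (p i) ^ 2) π :=
    integrable_finsetSum _ fun i _ => hYi i
  have hYint : ∫ p : Fin m → E × Θ, ∑ i, F (p i) ^ 2 ∂π = m * σ ^ 2 := by
    rw [integral_finsetSum _ fun i _ => hYi i]
    have : ∀ i : Fin m, ∫ p : Fin m → E × Θ, F (p i) ^ 2 ∂π = σ ^ 2 := fun i => by
      rw [hσ, integral_comp_eval (μ := fun _ : Fin m => (stdGaussian E).prod ν)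
        (f := fun p => F p ^ 2) (by fun_prop)]
    simp [this]
  have hsq : Integrable (fun p : Fin m → E × Θ => √(∑ i, F (p i) ^ 2)) π := by
    refine (hY.add (integrable_const 1)).mono' (Measurable.aestronglyMeasurable (by fun_prop))
      (Filter.Eventually.of_forall fun p => ?_)
    have h3 : 0 ≤ ∑ i, F (p i) ^ 2 := by positivity
    rw [Real.norm_of_nonneg (Real.sqrt_nonneg _), Real.sqrt_le_left (by simp; positivity)]
    simp only [Pi.add_apply]
    nlinarith
  rw [← ofReal_integral_eq_lintegral_ofReal hsq
    (Filter.Eventually.of_forall fun _ => Real.sqrt_nonneg _)]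
  refine ENNReal.ofReal_le_ofReal ?_
  -- Jensen: the mean of √(∑ F²) is at most √(m σ²), so second moments of the multipliers suffice.
  have hJ := Real.strictConcaveOn_sqrt.concaveOn.le_map_integral (μ := π)
    Real.continuous_sqrt.continuousOn isClosed_Ici
    (Filter.Eventually.of_forall fun p : Fin m → E × Θ =>
      Finset.sum_nonneg fun i _ => sq_nonneg (F (p i))) hY hsq
  refine hJ.trans (le_of_eq ?_)
  rw [hYint, Real.sqrt_mul (Nat.cast_nonneg m), Real.sqrt_sq hσ0]

/-- Chernoff bound for the number of samples that fall into a set of small probability. -/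
lemma measure_pi_lt_card_le {X : Type*} [MeasurableSpace X] {μ : Measure X}
    [IsProbabilityMeasure μ] {B : Set X} (hB : MeasurableSet B) {α : ℝ} (hα : 0 < α)
    (hμ : μ.real B ≤ α / 8) (m : ℕ) :
    (Measure.pi fun _ : Fin m => μ) {p | α / 4 * m ≤ ∑ i, B.indicator 1 (p i)}
      ≤ ENNReal.ofReal (Real.exp (-(α ^ 2 / 128 * m))) := by
  have hI : Measurable (B.indicator (1 : X → ℝ)) := measurable_one.indicator hB
  have h1 := lintegral_exp_mul_le_of_sub_le_one (μ := μ) hI (fun b b' => by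
    have := Set.indicator_le_self' (s := B) (f := (1 : X → ℝ)) (fun _ _ => zero_le_one) b
    have h3 : 0 ≤ B.indicator (1 : X → ℝ) b' := Set.indicator_nonneg (fun _ _ => zero_le_one) _
    simp only [Pi.one_apply] at this
    linarith) (α / 8)
  rw [integral_indicator_one hB] at h1
  -- Each factor contributes (α/8)²/2 = α²/128 by Hoeffding and at most (α/8)(α/8) = α²/64 by its
  -- mean. The threshold subtracts α²/32, leaving exactly -α²/128.
  have h2 : ∫⁻ p : Fin m → X, ENNReal.ofReal (Real.exp (α / 8 * ∑ i, B.indicator 1 (p i)))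
      ∂(Measure.pi fun _ => μ) ≤ ENNReal.ofReal (Real.exp (m * (α ^ 2 / 128 + α ^ 2 / 64))) := by
    simp_rw [Finset.mul_sum, Real.exp_sum, ENNReal.ofReal_prod_of_nonneg
      fun _ _ => Real.exp_nonneg _]
    rw [lintegral_prod_eq_prod_lintegral_of_indepFun Finset.univ
      (fun i (p : Fin m → X) => ENNReal.ofReal (Real.exp (α / 8 * B.indicator 1 (p i))))
      (iIndepFun_pi (X := fun _ x => ENNReal.ofReal (Real.exp (α / 8 * B.indicator 1 x)))
        (fun _ => by fun_prop)) (fun _ => by fun_prop)]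
    rw [Finset.prod_congr rfl fun i _ => lintegral_pi_comp_eval (μ := μ)
      (F := fun x => ENNReal.ofReal (Real.exp (α / 8 * B.indicator 1 x))) (by fun_prop) i]
    rw [Finset.prod_const, Finset.card_univ, Fintype.card_fin]
    refine (pow_le_pow_left' h1 m).trans ?_
    rw [← ENNReal.ofReal_pow (Real.exp_nonneg _), ← Real.exp_nat_mul]
    refine ENNReal.ofReal_le_ofReal (Real.exp_le_exp.2 ?_)
    gcongr ?_ * ?_
    nlinarith
  have hmono : {p : Fin m → X | α / 4 * m ≤ ∑ i, B.indicator 1 (p i)} ⊆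
      {p | ENNReal.ofReal (Real.exp (α / 8 * (α / 4 * m))) ≤
        ENNReal.ofReal (Real.exp (α / 8 * ∑ i, B.indicator 1 (p i)))} := by
    intro p hp
    simp only [Set.mem_ofPred_eq] at hp ⊢
    gcongr
  refine (measure_mono hmono).trans ((meas_ge_le_lintegral_div
    (Measurable.aemeasurable (by fun_prop)) (by simp [Real.exp_pos]) (by simp)).trans ?_)
  refine (ENNReal.div_le_div_right h2 _).trans ?_
  rw [← ENNReal.ofReal_div_of_pos (Real.exp_pos _), ← Real.exp_sub]
  refine ENNReal.ofReal_le_ofReal (Real.exp_le_exp.2 (le_of_eq ?_))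
  ring

end MultiplierProcess

/-! ### Lower bounds for increments of the loss. -/

section Loss

lemma ConvexOn.add_mul_sub_le {D : Set ℝ} {q : ℝ → ℝ} (hq : ConvexOn ℝ D q) {x y q' : ℝ}
    (hx : x ∈ D) (hy : y ∈ D) (h : HasDerivAt q q' x) : q x + q' * (y - x) ≤ q y := by
  rcases lt_trichotomy x y with hxy | rfl | hxy
  · have := hq.le_slope_of_hasDerivAt hx hy hxy h
    rw [slope_def_field, le_div_iff₀ (by linarith)] at this
    linarith
  · simp
  · have := hq.slope_le_of_hasDerivAt hy hx hxy h
    rw [slope_def_field, div_le_iff₀ (by linarith)] at this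
    linarith

variable {Y : Set ℝ} {L : ℝ → Y → ℝ} {C CMN : ℝ}

lemma LossSmooth.hasDerivAt (hL : LossSmooth L) (v : ℝ) (y : Y) :
    HasDerivAt (fun u => L u y) (lossDeriv L v y) v :=
  ((hL y).differentiable (by norm_num)).differentiableAt.hasDerivAt

lemma LossSmooth.hasDerivAt_lossDeriv (hL : LossSmooth L) (v : ℝ) (y : Y) :
    HasDerivAt (fun u => lossDeriv L u y) (lossDeriv2 L v y) v := by
  have h1 : ContDiff ℝ 1 (deriv fun u => L u y) :=
    ((contDiff_succ_iff_deriv (n := 1)).1 (by simpa [one_add_one_eq_two] using hL y)).2.2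
  exact (h1.differentiable (by norm_num)).differentiableAt.hasDerivAt

/-- Continuity in v together with a Lipschitz bound in y uniform in v is joint continuity; it makes
the multipliers measurable. -/
lemma LossLipschitz.continuous_lossDeriv (hC : 0 < C) (hL : LossLipschitz L C) :
    Continuous fun p : Y × ℝ => lossDeriv L p.2 p.1 := by
  refine continuous_prod_of_continuous_lipschitzWith _ C.toNNReal (fun y => ?_) fun v => ?_
  · exact (hL.1 y).continuous_deriv le_rfl
  · refine LipschitzWith.of_dist_le_mul fun y y' => ?_
    rw [Real.coe_toNNReal _ hC.le, Real.dist_eq, Subtype.dist_eq, Real.dist_eq]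
    exact hL.2 v y y'

/-- On (-r, r) the loss minus CMN s²/2 has nonnegative second derivative, so it lies above its
tangent at v. The bound on |v| + |u| keeps both endpoints in the interval. -/
lemma LossSmooth.add_quadratic_le (hL : LossSmooth L) {y : Y} {r v u : ℝ}
    (hcurv : ∀ s, |s| < r → CMN ≤ lossDeriv2 L s y) (hvu : |v| + |u| < r) :
    L v y + lossDeriv L v y * u + CMN / 2 * u ^ 2 ≤ L (v + u) y := by
  have hd1 : ∀ s, HasDerivAt (fun s => L s y - CMN / 2 * s ^ 2) (lossDeriv L s y - CMN * s) s := by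
    intro s
    have := (hL.hasDerivAt s y).sub (((hasDerivAt_id s).pow 2).const_mul (CMN / 2))
    exact this.congr_deriv (by simp; ring)
  have hd2 : ∀ s, HasDerivAt (fun s => lossDeriv L s y - CMN * s) (lossDeriv2 L s y - CMN) s := by
    intro s
    have := (hL.hasDerivAt_lossDeriv s y).sub ((hasDerivAt_id s).const_mul CMN)
    exact this.congr_deriv (by rw [mul_one])
  have hconv : ConvexOn ℝ (Set.Ioo (-r) r) (fun s => L s y - CMN / 2 * s ^ 2) := by
    refine convexOn_of_hasDerivWithinAt2_nonneg (convex_Ioo _ _)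
      (fun s _ => (hd1 s).continuousAt.continuousWithinAt)
      (fun s _ => (hd1 s).hasDerivWithinAt) (fun s _ => (hd2 s).hasDerivWithinAt) fun s hs => ?_
    rw [interior_Ioo] at hs
    have := hcurv s (abs_lt.2 hs)
    linarith
  have h1 : v ∈ Set.Ioo (-r) r := abs_lt.1 (by linarith [abs_nonneg u])
  have h2 : v + u ∈ Set.Ioo (-r) r := abs_lt.1 ((abs_add_le v u).trans_lt hvu)
  have := hconv.add_mul_sub_le h1 h2 (hd1 v)
  nlinarith

/-- Mean value inequality for s ↦ L(s, y') - L(s, y), whose derivative is bounded by C|y' - y|. It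
lets the curvature argument run at the unperturbed observation. -/
lemma abs_loss_increment_sub_le (hS : LossSmooth L) (hL : LossLipschitz L C) (v u : ℝ) (y y' : Y) :
    |(L (v + u) y' - L v y') - (L (v + u) y - L v y)| ≤ C * |(y' : ℝ) - (y : ℝ)| * |u| := by
  have hd : ∀ s, HasDerivAt (fun s => L s y' - L s y) (lossDeriv L s y' - lossDeriv L s y) s :=
    fun s => (hS.hasDerivAt s y').sub (hS.hasDerivAt s y)
  have := convex_univ.norm_image_sub_le_of_norm_hasDerivWithin_le (𝕜 := ℝ)
    (f := fun s => L s y' - L s y) (x := v) (y := v + u)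
    (fun s _ => (hd s).hasDerivWithinAt) (fun s _ => hL.2 s y' y) (Set.mem_univ _) (Set.mem_univ _)
  rw [Real.norm_eq_abs, Real.norm_eq_abs, add_sub_cancel_left] at this
  refine le_trans (le_of_eq ?_) this
  congr 1
  ring

/-- A bounded Lipschitz minorant of the square, supported on `[-2, 2]`. -/
noncomputable def hat (x : ℝ) : ℝ := max 0 (min (|x| - 1 / 2) (2 - |x|))

lemma hat_nonneg (x : ℝ) : 0 ≤ hat x := le_max_left _ _

lemma hat_le_one (x : ℝ) : hat x ≤ 1 := by
  refine max_le zero_le_one ?_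
  rcases le_total (|x|) (3 / 2) with h | h
  · exact (min_le_left _ _).trans (by linarith)
  · exact (min_le_right _ _).trans (by linarith)

lemma hat_le_sq (x : ℝ) : hat x ≤ x ^ 2 := by
  refine max_le (sq_nonneg x) ((min_le_left _ _).trans ?_)
  nlinarith [sq_abs x, sq_nonneg (|x| - 1 / 2)]

lemma hat_eq_zero {x : ℝ} (h : 2 ≤ |x|) : hat x = 0 :=
  max_eq_left ((min_le_right _ _).trans (by linarith))

lemma lipschitzWith_hat : LipschitzWith 1 hat := by
  have h1 : LipschitzWith 1 fun x : ℝ => |x| - 1 / 2 := by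
    refine LipschitzWith.of_le_add fun x y => ?_
    rw [Real.dist_eq]
    linarith [abs_sub_abs_le_abs_sub x y]
  have h2 : LipschitzWith 1 fun x : ℝ => 2 - |x| := by
    refine LipschitzWith.of_le_add fun x y => ?_
    rw [dist_comm, Real.dist_eq]
    linarith [abs_sub_abs_le_abs_sub y x]
  have := (h1.min h2).const_max 0
  rwa [max_self] at this

lemma hat_pos {x : ℝ} (h1 : 1 / 2 < x) (h2 : x < 2) : 0 < hat x := by
  refine lt_max_of_lt_right (lt_min ?_ ?_) <;> rw [abs_of_pos (by linarith)] <;> linarith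

/-- Lower bound for the increment of the loss at a perturbed observation `y'`. -/
lemma le_loss_increment (hS : LossSmooth L) (hconv : LossConvex L) (hL : LossLipschitz L C)
    (hCMN : 0 < CMN) {t r κ ι : ℝ} (ht : 0 < t) (y y' : Y) (v x : ℝ)
    (hι : ι = 1 ∨ ι = 0 ∧ |v| ≤ κ ∧ κ + 2 * t < r ∧ ∀ s, |s| < r → CMN ≤ lossDeriv2 L s y) :
    lossDeriv L v y * (t * x) + CMN / 2 * t ^ 2 * (hat x - ι)
        - C * |(y' : ℝ) - (y : ℝ)| * |t * x|
      ≤ L (v + t * x) y' - L v y' := by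
  have h1 := neg_le_of_abs_le (abs_loss_increment_sub_le hS hL v (t * x) y y')
  suffices h : lossDeriv L v y * (t * x) + CMN / 2 * t ^ 2 * (hat x - ι) ≤ L (v + t * x) y - L v y by
    linarith
  have htan := (hconv y).add_mul_sub_le (Set.mem_univ v) (Set.mem_univ (v + t * x))
    (hS.hasDerivAt v y)
  simp only [add_sub_cancel_left] at htan
  have hc : 0 ≤ CMN / 2 * t ^ 2 := by positivity
  rcases hι with rfl | ⟨rfl, hv, hr, hcurv⟩
  -- For an exceptional sample `hat x - 1` is nonpositive, so the tangent bound from convexity is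
  -- enough.
  · nlinarith [hat_le_one x]
  -- For |x| ≥ 2 the minorant vanishes and the tangent suffices again. Otherwise the step has length
  -- at most 2t and stays in the region of curvature.
  · rcases le_or_gt 2 |x| with hx | hx
    · rw [hat_eq_zero hx]
      linarith
    · have hu : |t * x| ≤ 2 * t := by rw [abs_mul, abs_of_pos ht]; nlinarith
      have := hS.add_quadratic_le hcurv (v := v) (u := t * x) (by linarith)
      have h3 := mul_le_mul_of_nonneg_left (hat_le_sq x) hc
      nlinarith

end Loss

/-! ### Positivity of the two numerical moments behind the constants. -/

section Constants

lemma gaussianReal_pos_of_isOpen {U : Set ℝ} (hU : IsOpen U) (hne : U.Nonempty) :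
    0 < gaussianReal 0 1 U := by
  rw [pos_iff_ne_zero]
  intro h
  exact (hU.measure_pos volume hne).ne' (gaussianReal_absolutelyContinuous' 0 one_ne_zero h)

lemma integrable_hat : Integrable hat (gaussianReal 0 1) :=
  (integrable_const (1 : ℝ)).mono' lipschitzWith_hat.continuous.aestronglyMeasurable
    (Filter.Eventually.of_forall fun x => by
      rw [Real.norm_of_nonneg (hat_nonneg x)]; exact hat_le_one x)

lemma integral_hat_pos : 0 < ∫ x, hat x ∂gaussianReal 0 1 := by
  rw [integral_pos_iff_support_of_nonneg hat_nonneg integrable_hat]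
  refine (gaussianReal_pos_of_isOpen isOpen_Ioo ⟨1, ?_⟩).trans_le
    (measure_mono (s := Set.Ioo (1 / 2) 2) fun x hx => (hat_pos hx.1 hx.2).ne')
  constructor <;> norm_num

lemma integral_hat_le_one : ∫ x, hat x ∂gaussianReal 0 1 ≤ 1 := by
  refine (integral_mono integrable_hat (integrable_const 1) hat_le_one).trans ?_
  simp

lemma integrable_abs_gaussianReal : Integrable (fun x : ℝ => |x|) (gaussianReal 0 1) :=
  (IsGaussian.integrable_id (μ := gaussianReal 0 1)).abs

lemma integral_abs_gaussianReal_pos : 0 < ∫ x, |x| ∂gaussianReal 0 1 := by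
  rw [integral_pos_iff_support_of_nonneg (fun x => abs_nonneg x) integrable_abs_gaussianReal]
  refine (gaussianReal_pos_of_isOpen isOpen_Ioi ⟨1, ?_⟩).trans_le
    (measure_mono (s := Set.Ioi 0) fun x hx => ?_)
  · simp
  · simpa using (ne_of_gt hx : x ≠ 0)

end Constants

/-! ### The good event. -/

section GoodEvent

variable {E : Type*} [NormedAddCommGroup E] [InnerProductSpace ℝ E] [FiniteDimensional ℝ E]
  [MeasurableSpace E] [BorelSpace E] {T : Set E}
  {Θ : Type*} [MeasurableSpace Θ] {ν : Measure Θ} [IsProbabilityMeasure ν]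

lemma integral_hat_inner {x : E} (hx : ‖x‖ = 1) :
    ∫ b, hat (inner ℝ b x) ∂stdGaussian E = ∫ s, hat s ∂gaussianReal 0 1 := by
  rw [← map_inner_stdGaussian hx, integral_map (by fun_prop)
    lipschitzWith_hat.continuous.aestronglyMeasurable]

/-- A set that contains the origin and a unit vector has Gaussian width bounded below. -/
lemma integral_abs_le_integral_affSup_zero (hT : ∀ x ∈ T, ‖x‖ ≤ 1) (h0 : (0 : E) ∈ T) {x : E}
    (hxT : x ∈ T) (hx : ‖x‖ = 1) :
    (∫ s, |s| ∂gaussianReal 0 1) / 2 ≤ ∫ g, affSup T 0 g ∂stdGaussian E := by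
  have : Nonempty T := ⟨⟨0, h0⟩⟩
  have h1 := IsGaussian.integrable_dual (stdGaussian E) (innerSL ℝ x)
  have h2 := integral_strongDual_stdGaussian (innerSL ℝ x)
  have h3 : ∫ g, |inner ℝ g x| ∂stdGaussian E = ∫ s, |s| ∂gaussianReal 0 1 := by
    rw [← map_inner_stdGaussian hx, integral_map (by fun_prop) (by fun_prop)]
  have h4 : Integrable (fun g => |inner ℝ g x|) (stdGaussian E) :=
    h1.abs.congr (Filter.Eventually.of_forall fun g => by simp [real_inner_comm])
  -- The supremum over {0, x} is max(⟨g, x⟩, 0) = (⟨g, x⟩ + |⟨g, x⟩|)/2, and ⟨g, x⟩ is centered.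
  have h5 : ∫ g, (1 / 2 * (innerSL ℝ x) g + 1 / 2 * |inner ℝ g x|) ∂stdGaussian E
      = (∫ s, |s| ∂gaussianReal 0 1) / 2 := by
    rw [integral_add (h1.const_mul _) (h4.const_mul _), integral_const_mul, integral_const_mul, h2,
      h3]
    ring
  rw [← h5]
  refine integral_mono ((h1.const_mul _).add (h4.const_mul _))
    (integrable_affSup_id hT bddAbove_range_zero) fun g => ?_
  have h6 := le_affSup hT bddAbove_range_zero g ⟨x, hxT⟩
  have h7 := le_affSup hT bddAbove_range_zero g ⟨0, h0⟩
  simp only [Pi.zero_apply, zero_add, inner_zero_right] at h6 h7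
  rw [innerSL_apply_apply, real_inner_comm]
  rcases abs_cases (inner ℝ g x) with h | h <;> linarith

/-- The event on which the deterministic recovery argument works. -/
theorem exists_good_event (hT : ∀ x ∈ T, ‖x‖ ≤ 1) (h0 : (0 : E) ∈ T)
    (hT1 : ∃ x ∈ T, ‖x‖ = 1) {z : E} (hz : ‖z‖ = 1) {F : E × Θ → ℝ} (hF : Measurable F)
    (hFz : ∀ b b' θ, F (inner ℝ z b • z + projOrth z b', θ) = F (b, θ))
    (hF2 : Integrable (fun p => F p ^ 2) ((stdGaussian E).prod ν)) {σ η : ℝ} (hσ0 : 0 ≤ σ)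
    (hσ : σ ^ 2 = ∫ p, F p ^ 2 ∂((stdGaussian E).prod ν))
    (hη2 : MemLp (fun p => F p * inner ℝ z p.1) 2 ((stdGaussian E).prod ν))
    (hmean : ∫ p, F p * inner ℝ z p.1 ∂((stdGaussian E).prod ν) = 0)
    (hη : η ^ 2 = ∫ p, (F p * inner ℝ z p.1) ^ 2 ∂((stdGaussian E).prod ν))
    {α : ℝ} (hα : α = ∫ s, hat s ∂gaussianReal 0 1)
    {B : Set (E × Θ)} (hB : MeasurableSet B) (hBα : ((stdGaussian E).prod ν).real B ≤ α / 8)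
    {m : ℕ} (hm1 : 2 * (∫ g, affSup T 0 g ∂stdGaussian E) ^ 2 ≤ m)
    (hm2 : 32 * ∫ g, affSup T 0 g ∂stdGaussian E ≤ α * √m) {τ : ℝ} (hτ : 0 < τ) :
    ∃ W : Set (Fin m → E × Θ), MeasurableSet W ∧
      (Measure.pi fun _ => (stdGaussian E).prod ν) W
        ≤ ENNReal.ofReal (2 * τ + 3 * Real.exp (-(α ^ 2 / 128 * m))) ∧
      ∀ p ∉ W,
        (∀ x ∈ T, ∑ i, inner ℝ (p i).1 x ^ 2 ≤ 100 * m) ∧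
        (∀ x ∈ T, ‖x‖ = 1 → 3 / 4 * α * m ≤ ∑ i, hat (inner ℝ (p i).1 x)) ∧
        ∑ i, B.indicator 1 (p i) ≤ α / 4 * m ∧
        (∑ i, F (p i) * inner ℝ z (p i).1) ^ 2 ≤ m * η ^ 2 / τ ∧
        affSup T 0 (∑ i, (-F (p i)) • projOrth z (p i).1)
          ≤ √m * σ * (∫ g, affSup T 0 g ∂stdGaussian E) / τ := by
  have : Nonempty T := ⟨⟨0, h0⟩⟩
  have hα0 : 0 < α := hα ▸ integral_hat_pos
  have hα1 : α ≤ 1 := hα ▸ integral_hat_le_one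
  have hw0 := integral_affSup_zero_nonneg (E := E) hT
  have hc : Continuous (affSup T (0 : T → ℝ)) :=
    (lipschitzWith_affSup hT bddAbove_range_zero).continuous
  set w := ∫ g, affSup T 0 g ∂stdGaussian E
  set ρ := (stdGaussian E).prod ν
  -- the unit vectors in `T`
  let T' : Set E := {x | x ∈ T ∧ ‖x‖ = 1}
  have : Nonempty T' := by obtain ⟨x, hx⟩ := hT1; exact ⟨⟨x, hx⟩⟩
  have hT' : ∀ x ∈ T', ‖x‖ ≤ 1 := fun x hx => hx.2.le
  have hw' : ∫ g, affSup T' 0 g ∂stdGaussian E ≤ w := by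
    refine integral_mono (integrable_affSup_id hT' bddAbove_range_zero)
      (integrable_affSup_id hT bddAbove_range_zero) fun g => affSup_le fun x => ?_
    exact le_affSup hT bddAbove_range_zero g ⟨x, x.2.1⟩
  obtain ⟨V1, hV1m, hV1, hV1b⟩ := exists_measurableSet_sum_inner_sq_le hT hm1
  obtain ⟨V2, hV2m, hV2, hV2b⟩ := exists_measurableSet_le_sum_comp_inner hT' lipschitzWith_hat
    hat_nonneg hat_le_one hα0 (fun x hx => (integral_hat_inner hx.2).trans hα.symm) (m := m)
    (by linarith)
  have hpr : MeasurePreserving (fun (p : Fin m → E × Θ) i => (p i).1)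
      (Measure.pi fun _ => ρ) (Measure.pi fun _ => stdGaussian E) :=
    measurePreserving_pi (fun _ : Fin m => ρ) _ fun _ => measurePreserving_fst
  have hV3 := measure_pi_lt_card_le hB hα0 hBα m
  have hV4 := measure_lt_le_of_lintegral_le (G := fun p : Fin m → E × Θ =>
    ENNReal.ofReal ((∑ i, F (p i) * inner ℝ z (p i).1) ^ 2)) (by fun_prop) hτ
    (κ := m * η ^ 2) (by positivity) (by rw [hη]; exact (lintegral_sum_sq_pi hη2 hmean m).le)
  have hV5 := measure_lt_le_of_lintegral_le (G := fun p : Fin m → E × Θ =>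
    ENNReal.ofReal (affSup T 0 (∑ i, (-F (p i)) • projOrth z (p i).1))) (by fun_prop) hτ
    (κ := √m * σ * w) (by positivity) (lintegral_affSup_multiplier_le hT h0 hz hF hFz hF2 hσ0 hσ m)
  set pr := fun (p : Fin m → E × Θ) i => (p i).1
  set W3 := {p : Fin m → E × Θ | α / 4 * m ≤ ∑ i, B.indicator 1 (p i)} with hW3
  set W4 := {p : Fin m → E × Θ | ENNReal.ofReal (m * η ^ 2 / τ)
    < ENNReal.ofReal ((∑ i, F (p i) * inner ℝ z (p i).1) ^ 2)} with hW4
  set W5 := {p : Fin m → E × Θ | ENNReal.ofReal (√m * σ * w / τ)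
    < ENNReal.ofReal (affSup T 0 (∑ i, (-F (p i)) • projOrth z (p i).1))} with hW5
  have hI : Measurable (B.indicator (1 : E × Θ → ℝ)) := measurable_one.indicator hB
  have hW3m : MeasurableSet W3 := measurableSet_le measurable_const (by fun_prop)
  have hW4m : MeasurableSet W4 := measurableSet_lt measurable_const (by fun_prop)
  have hW5m : MeasurableSet W5 := measurableSet_lt measurable_const (by fun_prop)
  have he : Real.exp (-m) ≤ Real.exp (-(α ^ 2 / 128 * m)) := by
    refine Real.exp_le_exp.2 (neg_le_neg ?_)
    have : α ^ 2 ≤ 1 := pow_le_one₀ hα0.le hα1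
    exact mul_le_of_le_one_left (Nat.cast_nonneg m) (by linarith)
  refine ⟨pr ⁻¹' V1 ∪ pr ⁻¹' V2 ∪ W3 ∪ W4 ∪ W5, ((((hpr.measurable hV1m).union
    (hpr.measurable hV2m)).union hW3m).union hW4m).union hW5m, ?_, ?_⟩
  · refine (measure_union_le _ _).trans ((add_le_add_left (measure_union_le _ _) _).trans
      ((add_le_add_left (add_le_add_left (measure_union_le _ _) _) _).trans
      ((add_le_add_left (add_le_add_left (add_le_add_left (measure_union_le _ _) _) _) _).trans ?_)))
    rw [hpr.measure_preimage hV1m.nullMeasurableSet, hpr.measure_preimage hV2m.nullMeasurableSet]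
    have hsplit : 2 * τ + 3 * Real.exp (-(α ^ 2 / 128 * m)) = Real.exp (-(α ^ 2 / 128 * m)) +
        Real.exp (-(α ^ 2 / 128 * m)) + Real.exp (-(α ^ 2 / 128 * m)) + τ + τ := by ring
    rw [hsplit, ENNReal.ofReal_add (by positivity) hτ.le, ENNReal.ofReal_add (by positivity) hτ.le,
      ENNReal.ofReal_add (by positivity) (by positivity),
      ENNReal.ofReal_add (by positivity) (by positivity)]
    gcongr
    exact hV1.trans (ENNReal.ofReal_le_ofReal he)
  · intro p hp
    simp only [Set.mem_union, not_or, Set.mem_preimage] at hp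
    obtain ⟨⟨⟨⟨hp1, hp2⟩, hp3⟩, hp4⟩, hp5⟩ := hp
    refine ⟨fun x hx => hV1b _ hp1 x hx, fun x hx hx1 => hV2b _ hp2 x ⟨hx, hx1⟩, ?_, ?_, ?_⟩
    · simp only [hW3, Set.mem_ofPred_eq, not_le] at hp3
      exact hp3.le
    · simp only [hW4, Set.mem_ofPred_eq, not_lt] at hp4
      exact (ENNReal.ofReal_le_ofReal_iff (by positivity)).1 hp4
    · simp only [hW5, Set.mem_ofPred_eq, not_lt] at hp5
      exact (ENNReal.ofReal_le_ofReal_iff (by positivity)).1 hp5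

end GoodEvent

/-! ### Deterministic lower bound for the excess empirical loss. -/

section Deterministic

variable {E : Type*} [NormedAddCommGroup E] [InnerProductSpace ℝ E]
  {Y : Set ℝ} {L : ℝ → Y → ℝ} {C CMN : ℝ}

/-- Cauchy–Schwarz: the ℓ² norm of the perturbation is √m ε, and that of u is at most q √m. -/
lemma sum_abs_mul_abs_le_advNoise {m : ℕ} (y y' : Fin m → Y) (u : Fin m → ℝ) {q : ℝ} (hq : 0 ≤ q)
    (hu : ∑ i, u i ^ 2 ≤ q ^ 2 * m) :
    ∑ i, |(y' i : ℝ) - (y i : ℝ)| * |u i| ≤ q * m * advNoise y y' := by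
  rcases Nat.eq_zero_or_pos m with rfl | hm
  · simp
  have hm' : (0 : ℝ) < m := by exact_mod_cast hm
  refine (Real.sum_mul_le_sqrt_mul_sqrt _ _ _).trans ?_
  simp only [sq_abs]
  have h1 : √(∑ i, u i ^ 2) ≤ q * √m := by
    rw [← Real.sqrt_sq hq, ← Real.sqrt_mul (sq_nonneg q)]
    exact Real.sqrt_le_sqrt hu
  have h2 : √(∑ i, ((y' i : ℝ) - (y i : ℝ)) ^ 2) = √m * advNoise y y' := by
    rw [advNoise, ← Real.sqrt_mul hm'.le]
    simp only [sq_abs]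
    congr 1
    field_simp
  rw [h2]
  have h3 : √(m : ℝ) * √m = m := Real.mul_self_sqrt hm'.le
  have h4 : 0 ≤ √m * advNoise y y' := mul_nonneg (Real.sqrt_nonneg _) (Real.sqrt_nonneg _)
  calc √m * advNoise y y' * √(∑ i, u i ^ 2) ≤ √m * advNoise y y' * (q * √m) := by gcongr
    _ = q * m * advNoise y y' := by linear_combination q * advNoise y y' * h3

/-- Lower bound for the excess empirical loss in a direction of norm `t`. -/
lemma le_sum_loss_increment (hS : LossSmooth L) (hconv : LossConvex L) (hL : LossLipschitz L C)
    (hCMN : 0 < CMN) (hC : 0 < C) {t r κ α Q₁ Q₂ μ : ℝ} (ht : 0 < t) (hr : κ + 2 * t < r)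
    {m : ℕ} {y y' : Fin m → Y} {b : Fin m → E} {z x : E} (hz : ‖z‖ = 1) (hx : ‖x‖ = 1)
    {ι : Fin m → ℝ}
    (hι : ∀ i, ι i = 1 ∨ ι i = 0 ∧ |μ * inner ℝ z (b i)| ≤ κ ∧
      ∀ s, |s| < r → CMN ≤ lossDeriv2 L s (y i))
    (hια : ∑ i, ι i ≤ α / 4 * m) (hquad : ∑ i, inner ℝ (b i) x ^ 2 ≤ 100 * m)
    (hhat : 3 / 4 * α * m ≤ ∑ i, hat (inner ℝ (b i) x))
    (h₁ : |∑ i, lossDeriv L (μ * inner ℝ z (b i)) (y i) * inner ℝ z (b i)| ≤ Q₁)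
    (h₂ : inner ℝ (∑ i, (-lossDeriv L (μ * inner ℝ z (b i)) (y i)) • projOrth z (b i)) x ≤ Q₂) :
    CMN * α / 4 * t ^ 2 * m - t * (Q₁ + Q₂) - 10 * C * t * m * advNoise y y'
      ≤ ∑ i, (L (μ * inner ℝ z (b i) + t * inner ℝ (b i) x) (y' i)
        - L (μ * inner ℝ z (b i)) (y' i)) := by
  set g : Fin m → ℝ := fun i => inner ℝ z (b i) with hg
  set u : Fin m → ℝ := fun i => inner ℝ (b i) x with hu
  set ξ : Fin m → ℝ := fun i => lossDeriv L (μ * g i) (y i) with hξ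
  have hpt : ∀ i, ξ i * (t * u i) + CMN / 2 * t ^ 2 * (hat (u i) - ι i)
      - C * |(y' i : ℝ) - (y i : ℝ)| * |t * u i|
      ≤ L (μ * g i + t * u i) (y' i) - L (μ * g i) (y' i) := fun i =>
    le_loss_increment hS hconv hL hCMN ht (y i) (y' i) (μ * g i) (u i)
      ((hι i).imp id fun h => ⟨h.1, h.2.1, hr, h.2.2⟩)
  refine le_trans ?_ (Finset.sum_le_sum fun i _ => hpt i)
  have e1 : ∑ i, (ξ i * (t * u i) + CMN / 2 * t ^ 2 * (hat (u i) - ι i)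
      - C * |(y' i : ℝ) - (y i : ℝ)| * |t * u i|)
      = t * ∑ i, ξ i * u i + CMN / 2 * t ^ 2 * (∑ i, hat (u i) - ∑ i, ι i)
        - C * t * ∑ i, |(y' i : ℝ) - (y i : ℝ)| * |u i| := by
    rw [Finset.sum_sub_distrib, Finset.sum_add_distrib, ← Finset.sum_sub_distrib, Finset.mul_sum,
      Finset.mul_sum, Finset.mul_sum]
    congr 1
    · congr 1
      refine Finset.sum_congr rfl fun i _ => ?_
      ring
    · refine Finset.sum_congr rfl fun i _ => ?_
      rw [abs_mul, abs_of_pos ht]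
      ring
  -- Each bᵢ is split as gᵢ z plus its orthogonal projection.
  have e2 : ∑ i, ξ i * u i = inner ℝ z x * (∑ i, ξ i * g i)
      - inner ℝ (∑ i, (-ξ i) • projOrth z (b i)) x := by
    rw [sum_inner, Finset.mul_sum, ← Finset.sum_sub_distrib]
    refine Finset.sum_congr rfl fun i _ => ?_
    rw [real_inner_smul_left, projOrth_apply, inner_sub_left, real_inner_smul_left]
    simp only [hu, hg]
    ring
  have e3 : |inner ℝ z x * ∑ i, ξ i * g i| ≤ Q₁ := by
    rw [abs_mul]
    have : |inner ℝ z x| ≤ 1 := by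
      refine (abs_real_inner_le_norm z x).trans ?_
      rw [hz, hx, one_mul]
    exact (mul_le_of_le_one_left (abs_nonneg _) this).trans h₁
  have e4 : ∑ i, |(y' i : ℝ) - (y i : ℝ)| * |u i| ≤ 10 * m * advNoise y y' :=
    sum_abs_mul_abs_le_advNoise y y' u (by norm_num) (by norm_num; exact hquad)
  have e5 : -(Q₁ + Q₂) ≤ ∑ i, ξ i * u i := by
    rw [e2]
    linarith [(abs_le.1 e3).1]
  rw [e1]
  have f1 := mul_le_mul_of_nonneg_left e5 ht.le
  have f2 := mul_le_mul_of_nonneg_left e4 (by positivity : 0 ≤ C * t)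
  -- Curvature left over after the exceptional samples: 3α/4 - α/4 = α/2.
  have f3 := mul_le_mul_of_nonneg_left (by linarith : α / 2 * m ≤ ∑ i, hat (u i) - ∑ i, ι i)
    (by positivity : 0 ≤ CMN / 2 * t ^ 2)
  linarith

end Deterministic

/-! ### Rescaling of the width and whitening of the sample. -/

section Reduction

variable {n : ℕ}

/-- Substituting x ↦ t x brings the constraint to the unit ball; after division by t², the effective
dimension is the squared width of the rescaled set. -/
lemma localMeanWidth_eq {t : ℝ} (ht : 0 < t) (V : Set (EuclideanSpace ℝ (Fin n))) :
    localMeanWidth t V = t * ∫ g, affSup {x | t • x ∈ V ∧ ‖x‖ ≤ 1} 0 g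
      ∂stdGaussian (EuclideanSpace ℝ (Fin n)) := by
  rw [localMeanWidth, meanWidth, ← integral_const_mul]
  congr 1 with g
  rw [affSup, Real.mul_iSup_of_nonneg ht.le]
  symm
  refine Function.Surjective.iSup_congr (fun x => ⟨t • x.1, x.2.1, ?_⟩) ?_ fun x => ?_
  · rw [mem_closedBall_zero_iff, norm_smul, Real.norm_of_nonneg ht.le]
    exact mul_le_of_le_one_right ht.le x.2.2
  · rintro ⟨v, hv, hv'⟩
    rw [mem_closedBall_zero_iff] at hv'
    have h1 : t • t⁻¹ • v = v := smul_inv_smul₀ ht.ne' v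
    refine ⟨⟨t⁻¹ • v, ⟨by rwa [h1], ?_⟩⟩, Subtype.ext h1⟩
    rw [norm_smul, Real.norm_of_nonneg (by positivity)]
    exact inv_mul_le_one_of_le₀ hv' ht.le
  · simp [real_inner_smul_right]

variable {S : Matrix (Fin n) (Fin n) ℝ}

lemma inner_sqrtCov (x y : EuclideanSpace ℝ (Fin n)) :
    inner ℝ (sqrtCov S x) y = inner ℝ x (sqrtCov S y) := by
  have h : IsSelfAdjoint (sqrtCov S) := (CFC.sqrt_nonneg S).isSelfAdjoint.map _
  rw [← ContinuousLinearMap.adjoint_inner_left, h.adjoint_eq]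

lemma exists_inverse_sqrtCov (hS : S.PosDef) :
    ∃ R : EuclideanSpace ℝ (Fin n) →L[ℝ] EuclideanSpace ℝ (Fin n),
      (∀ x, R (sqrtCov S x) = x) ∧ ∀ x, sqrtCov S (R x) = x := by
  have h1 : CFC.sqrt S * CFC.sqrt S = S := CFC.sqrt_mul_sqrt_self S hS.posSemidef.nonneg
  have h2 : IsUnit (CFC.sqrt S) := by
    have h3 : IsUnit (CFC.sqrt S * CFC.sqrt S) := h1.symm ▸ hS.isUnit
    exact isUnit_of_mul_isUnit_left h3
  obtain ⟨U, hU⟩ := h2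
  refine ⟨Matrix.toEuclideanCLM (𝕜 := ℝ) (U⁻¹).1, fun x => ?_, fun x => ?_⟩
  · rw [sqrtCov, ← hU, ← ContinuousLinearMap.comp_apply, ← ContinuousLinearMap.mul_def, ← map_mul]
    simp
  · rw [sqrtCov, ← hU, ← ContinuousLinearMap.comp_apply, ← ContinuousLinearMap.mul_def, ← map_mul]
    simp

variable {Ω Θ : Type*} [MeasurableSpace Ω] [MeasurableSpace Θ] {m : ℕ} {Y : Set ℝ}
  {P : Measure Ω} {ν : Measure Θ}
  {a : Fin m → Ω → EuclideanSpace ℝ (Fin n)} {θ : Fin m → Ω → Θ} {f : ℝ → Θ → Y}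

/-- The whitened samples `(S^{-1/2} aᵢ, θᵢ)` are independent with law `N(0, Iₙ) ⊗ ν`. -/
lemma IsMeasurementModel.hasLaw_whitened [IsProbabilityMeasure P] [IsProbabilityMeasure ν]
    (hM : IsMeasurementModel P ν S a θ f)
    {R : EuclideanSpace ℝ (Fin n) →L[ℝ] EuclideanSpace ℝ (Fin n)}
    (hR : ∀ x, R (sqrtCov S x) = x) :
    HasLaw (fun ω i => (R (a i ω), θ i ω))
      (Measure.pi fun _ => (stdGaussian (EuclideanSpace ℝ (Fin n))).prod ν) P := by
  have ha : ∀ i, AEMeasurable (a i) P := fun i => (hM.law_a i).aemeasurable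
  have hθ : ∀ i, AEMeasurable (θ i) P := fun i => (hM.law_θ i).aemeasurable
  have ha' : AEMeasurable (fun ω i => a i ω) P := aemeasurable_pi_lambda _ ha
  have hθ' : AEMeasurable (fun ω i => θ i ω) P := aemeasurable_pi_lambda _ hθ
  have h1 : P.map (fun ω i => a i ω) = Measure.pi fun _ => multivariateGaussian 0 S := by
    rw [(iIndepFun_iff_map_fun_eq_pi_map ha).1 hM.indep_a]
    congr 1 with i
    rw [(hM.law_a i).map_eq]
  have h2 : P.map (fun ω i => θ i ω) = Measure.pi fun _ => ν := by
    rw [(iIndepFun_iff_map_fun_eq_pi_map hθ).1 hM.indep_θ]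
    congr 1 with i
    rw [(hM.law_θ i).map_eq]
  have h3 := (indepFun_iff_map_prod_eq_prod_map_map ha' hθ').1 hM.indep_a_θ
  rw [h1, h2] at h3
  have hRmp : MeasurePreserving R (multivariateGaussian 0 S)
      (stdGaussian (EuclideanSpace ℝ (Fin n))) := by
    refine ⟨by fun_prop, ?_⟩
    rw [multivariateGaussian, Measure.map_map (by fun_prop) (by fun_prop)]
    have : R ∘ (fun x => 0 + Matrix.toEuclideanCLM (𝕜 := ℝ) (CFC.sqrt S) x) = id := by
      ext1 x
      simpa [sqrtCov] using hR x
    rw [this, Measure.map_id]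
  have hmp : MeasurePreserving (fun (p : (Fin m → EuclideanSpace ℝ (Fin n)) × (Fin m → Θ)) i =>
      (R (p.1 i), p.2 i)) ((Measure.pi fun _ => multivariateGaussian 0 S).prod
        (Measure.pi fun _ => ν))
      (Measure.pi fun _ => (stdGaussian (EuclideanSpace ℝ (Fin n))).prod ν) :=
    (measurePreserving_pi (fun _ : Fin m => (multivariateGaussian 0 S).prod ν) _
      fun _ => hRmp.prod (MeasurePreserving.id ν)).comp
      (measurePreserving_arrowProdEquivProdArrow (EuclideanSpace ℝ (Fin n)) Θ (Fin m) _ _).symm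
  refine ⟨hmp.measurable.comp_aemeasurable (ha'.prodMk hθ'), ?_⟩
  have h4 := AEMeasurable.map_map_of_aemeasurable hmp.measurable.aemeasurable (ha'.prodMk hθ')
  rw [h3, hmp.map_eq] at h4
  exact h4.symm

end Reduction

/-! ### From a distant minimizer to a contradiction on the good event. -/

section Recovery

variable {n m : ℕ} {Y : Set ℝ} {S : Matrix (Fin n) (Fin n) ℝ}

/-- If a minimizer is farther than `t` from the target, then by convexity the empirical loss does
not increase in some direction of norm `t`. -/
lemma IsEstimator.exists_direction {L : ℝ → Y → ℝ} (hconv : LossConvex L)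
    {K : Set (EuclideanSpace ℝ (Fin n))} (hK : Convex ℝ K) {x₁ : EuclideanSpace ℝ (Fin n)}
    (hx₁ : x₁ ∈ K) {a : Fin m → EuclideanSpace ℝ (Fin n)} {y' : Fin m → Y}
    {x : EuclideanSpace ℝ (Fin n)} (hx : IsEstimator L K a y' x) {t : ℝ} (ht : 0 < t)
    (hxt : t < ‖sqrtCov S (x - x₁)‖) :
    ∃ h, t • h ∈ (fun x => sqrtCov S (x - x₁)) '' K ∧ ‖h‖ = 1 ∧
      ∀ b : Fin m → EuclideanSpace ℝ (Fin n), (∀ i x, inner ℝ (a i) x = inner ℝ (b i) (sqrtCov S x)) →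
        ∑ i, (L (inner ℝ (a i) x₁ + t * inner ℝ (b i) h) (y' i) - L (inner ℝ (a i) x₁) (y' i)) ≤ 0 := by
  set v := sqrtCov S (x - x₁) with hv
  have hv0 : 0 < ‖v‖ := ht.trans hxt
  -- The point of the segment from the target to the minimizer at distance exactly t; it lies in K
  -- by convexity.
  set s := t / ‖v‖ with hs
  have hs0 : 0 ≤ s := by positivity
  have hs1 : s ≤ 1 := (div_le_one hv0).2 hxt.le
  have hz : (1 - s) • x₁ + s • x ∈ K := hK hx₁ hx.1 (by linarith) hs0 (by ring)
  have hts : t • ‖v‖⁻¹ • v = s • v := by rw [smul_smul, hs, div_eq_mul_inv]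
  refine ⟨‖v‖⁻¹ • v, ⟨_, hz, ?_⟩, ?_, fun b hb => ?_⟩
  · rw [hts]
    dsimp only
    rw [show (1 - s) • x₁ + s • x - x₁ = s • (x - x₁) by module, map_smul]
  · rw [norm_smul, norm_inv, norm_norm, inv_mul_cancel₀ hv0.ne']
  · have hpt : ∀ i, L (inner ℝ (a i) x₁ + t * inner ℝ (b i) (‖v‖⁻¹ • v)) (y' i)
        - L (inner ℝ (a i) x₁) (y' i)
        ≤ s * (L (inner ℝ (a i) x) (y' i) - L (inner ℝ (a i) x₁) (y' i)) := by
      intro i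
      have h1 := (hconv (y' i)).2 (Set.mem_univ (inner ℝ (a i) x₁)) (Set.mem_univ (inner ℝ (a i) x))
        (by linarith : 0 ≤ 1 - s) hs0 (by ring)
      simp only [smul_eq_mul] at h1
      have h2 : inner ℝ (a i) x₁ + t * inner ℝ (b i) (‖v‖⁻¹ • v)
          = (1 - s) * inner ℝ (a i) x₁ + s * inner ℝ (a i) x := by
        rw [← real_inner_smul_right, hts, real_inner_smul_right, hv, ← hb, inner_sub_right]
        ring
      rw [h2]
      linarith
    refine (Finset.sum_le_sum fun i _ => hpt i).trans ?_
    rw [← Finset.mul_sum, Finset.sum_sub_distrib]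
    refine mul_nonpos_of_nonneg_of_nonpos hs0 ?_
    rcases Nat.eq_zero_or_pos m with rfl | hm
    · simp
    have hm' : (0 : ℝ) < m := by exact_mod_cast hm
    have h3 := hx.2 x₁ hx₁
    rw [empLoss, empLoss] at h3
    have h4 := le_of_mul_le_mul_left h3 (by positivity)
    linarith

variable {Θ : Type*} [MeasurableSpace Θ] {ν : Measure Θ} [IsProbabilityMeasure ν] {f : ℝ → Θ → Y}

/-- The samples with a large signal or a large output are rare. -/
lemma measure_large_signal_or_output_le (hf : Measurable (Function.uncurry f)) {α : ℝ} (hα : 0 < α)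
    {N : ℝ≥0∞} (hN0 : 0 < N) (hN : ENNReal.ofReal (16 / α) * meanAbsOutput ν f ≤ N) :
    ((gaussianReal 0 1).prod ν) {q | 16 * (∫ s, |s| ∂gaussianReal 0 1) / α ≤ |q.1| ∨
      N ≤ ‖(f q.1 q.2 : ℝ)‖ₑ} ≤ ENNReal.ofReal (α / 8) := by
  have hβ := integral_abs_gaussianReal_pos
  set β := ∫ s, |s| ∂gaussianReal 0 1 with hβdef
  have h1 : ((gaussianReal 0 1).prod ν) {q | 16 * β / α ≤ |q.1|} ≤ ENNReal.ofReal (α / 16) := by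
    have h2 : ((gaussianReal 0 1).prod ν) {q | 16 * β / α ≤ |q.1|}
        = gaussianReal 0 1 {s | ENNReal.ofReal (16 * β / α) ≤ ENNReal.ofReal |s|} := by
      rw [← (measurePreserving_fst (μ := gaussianReal 0 1) (ν := ν)).measure_preimage
        (measurableSet_le measurable_const (by fun_prop)).nullMeasurableSet]
      congr 1
      ext q
      simp
    rw [h2]
    refine (meas_ge_le_lintegral_div (by fun_prop)
      (ENNReal.ofReal_pos.2 (by positivity)).ne' (by simp)).trans ?_
    rw [← ofReal_integral_eq_lintegral_ofReal integrable_abs_gaussianReal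
      (Filter.Eventually.of_forall fun s => abs_nonneg s), ← hβdef,
      ← ENNReal.ofReal_div_of_pos (by positivity)]
    exact ENNReal.ofReal_le_ofReal (le_of_eq (by field_simp))
  have h3 : ((gaussianReal 0 1).prod ν) {q | N ≤ ‖(f q.1 q.2 : ℝ)‖ₑ} ≤ ENNReal.ofReal (α / 16) := by
    -- A real output never reaches the level ⊤. For finite N this is Markov's inequality, and the
    -- factor 16/α yields α/16.
    rcases eq_or_ne N ⊤ with rfl | hNt
    · simp
    have hfm : Measurable fun q : ℝ × Θ => ‖(f q.1 q.2 : ℝ)‖ₑ :=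
      (measurable_subtype_coe.comp hf).enorm
    refine (meas_ge_le_lintegral_div hfm.aemeasurable hN0.ne' hNt).trans ?_
    refine ENNReal.div_le_of_le_mul ?_
    have h4 : ENNReal.ofReal (α / 16) * ENNReal.ofReal (16 / α) = 1 := by
      rw [← ENNReal.ofReal_mul (by positivity)]
      simp [show α / 16 * (16 / α) = 1 by field_simp]
    have h5 := mul_le_mul_right hN (ENNReal.ofReal (α / 16))
    rwa [← mul_assoc, h4, one_mul] at h5
  refine (measure_mono (t := {q : ℝ × Θ | 16 * β / α ≤ |q.1|} ∪ {q | N ≤ ‖(f q.1 q.2 : ℝ)‖ₑ})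
    fun q hq => hq).trans ((measure_union_le _ _).trans ((add_le_add h1 h3).trans ?_))
  rw [← ENNReal.ofReal_add (by positivity) (by positivity)]
  exact ENNReal.ofReal_le_ofReal (by linarith)

variable {Ω : Type*} [MeasurableSpace Ω] {P : Measure Ω} [IsProbabilityMeasure P]
  {a : Fin m → Ω → EuclideanSpace ℝ (Fin n)} {θ : Fin m → Ω → Θ}

/-- The recovery bound in terms of the width `w` of the rescaled local descent set. -/
theorem measure_recovery_failure_le (hS : S.PosDef) (hM : IsMeasurementModel P ν S a θ f)
    {x₀ : EuclideanSpace ℝ (Fin n)} (hx₀ : ‖sqrtCov S x₀‖ = 1) (y' : Ω → Fin m → Y)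
    {L : ℝ → Y → ℝ} {CLip CMN : ℝ} (hCLip : 0 < CLip) (hCMN : 0 < CMN)
    (hLip : LossLipschitz L CLip) (hconv : LossConvex L) (hsm : LossSmooth L)
    {μ σ η : ℝ} (hμ : IsModelParameter ν f L μ σ η)
    {K : Set (EuclideanSpace ℝ (Fin n))} (hK : Convex ℝ K) (hμK : μ • x₀ ∈ K) {t : ℝ} (ht : 0 < t)
    {M N : ℝ≥0∞} (hN0 : 0 < N) {α β τ w : ℝ} (hα : α = ∫ s, hat s ∂gaussianReal 0 1)
    (hβ : β = ∫ s, |s| ∂gaussianReal 0 1) (hτ : 0 < τ) (hτ1 : τ ≤ 1)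
    (hMle : ENNReal.ofReal (max (32 * t) (32 * β / α * |μ|)) ≤ M) (hcurv : LossCurved L M N CMN)
    (hN : ENNReal.ofReal (16 / α) * meanAbsOutput ν f ≤ N)
    {T : Set (EuclideanSpace ℝ (Fin n))}
    (hT : T = {x | t • x ∈ (fun x => sqrtCov S (x - μ • x₀)) '' K ∧ ‖x‖ ≤ 1})
    (hT1 : ∃ x ∈ T, ‖x‖ = 1)
    (hw : w = ∫ g, affSup T 0 g ∂stdGaussian (EuclideanSpace ℝ (Fin n)))
    (hm0 : 0 < m) (hm1 : 2 * w ^ 2 ≤ m) (hm2 : 32 * w ≤ α * √m) :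
    P {ω | 4 / (CMN * α) * (1 / τ + 10 * CLip) *
            ((σ * w + η) / √(m : ℝ) + advNoise (observation a θ f x₀ ω) (y' ω)) < t ∧
          ∃ x, IsEstimator L K (fun i => a i ω) (y' ω) x ∧ ¬ ‖sqrtCov S (x - μ • x₀)‖ ≤ t}
      ≤ ENNReal.ofReal (2 * τ + 3 * Real.exp (-(α ^ 2 / 128 * m))) := by
  have hα0 : 0 < α := hα ▸ integral_hat_pos
  have hβ0 : 0 < β := hβ ▸ integral_abs_gaussianReal_pos
  have hm' : (0 : ℝ) < m := by exact_mod_cast hm0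
  set z := sqrtCov S x₀ with hz
  obtain ⟨R, hR1, hR2⟩ := exists_inverse_sqrtCov hS
  have hX := hM.hasLaw_whitened hR1
  have hTle : ∀ x ∈ T, ‖x‖ ≤ 1 := by rw [hT]; exact fun x hx => hx.2
  have hT0 : (0 : EuclideanSpace ℝ (Fin n)) ∈ T := by
    rw [hT]
    exact ⟨⟨_, hμK, by simp⟩, by simp⟩
  have hw0 : 0 ≤ w := by
    have : Nonempty T := ⟨⟨0, hT0⟩⟩
    exact hw ▸ integral_affSup_zero_nonneg hTle
  -- the multipliers
  have hΞ : Measurable fun q : ℝ × Θ => lossDeriv L (μ * q.1) (f q.1 q.2) :=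
    (hLip.continuous_lossDeriv hCLip).measurable.comp
      (hM.measurable_f.prodMk (by fun_prop : Measurable fun q : ℝ × Θ => μ * q.1))
  have hmp : MeasurePreserving (fun p : EuclideanSpace ℝ (Fin n) × Θ => (inner ℝ z p.1, p.2))
      ((stdGaussian (EuclideanSpace ℝ (Fin n))).prod ν) ((gaussianReal 0 1).prod ν) := by
    refine MeasurePreserving.prod (f := fun b => inner ℝ z b) (g := id) ⟨by fun_prop, ?_⟩
      (MeasurePreserving.id ν)
    rw [← map_inner_stdGaussian hx₀]
    simp_rw [real_inner_comm]
  have hint : ∀ {G : ℝ × Θ → ℝ}, Measurable G →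
      ∫ p : EuclideanSpace ℝ (Fin n) × Θ, G (inner ℝ z p.1, p.2)
        ∂((stdGaussian (EuclideanSpace ℝ (Fin n))).prod ν) = ∫ q, G q ∂((gaussianReal 0 1).prod ν) := by
    intro G hG
    rw [← hmp.map_eq, integral_map hmp.measurable.aemeasurable hG.aestronglyMeasurable]
  set B : Set (EuclideanSpace ℝ (Fin n) × Θ) := (fun p => (inner ℝ z p.1, p.2)) ⁻¹'
    {q | 16 * β / α ≤ |q.1| ∨ N ≤ ‖(f q.1 q.2 : ℝ)‖ₑ} with hBdef
  have hB0 : MeasurableSet {q : ℝ × Θ | 16 * β / α ≤ |q.1| ∨ N ≤ ‖(f q.1 q.2 : ℝ)‖ₑ} := by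
    have h1 : MeasurableSet {q : ℝ × Θ | 16 * β / α ≤ |q.1|} :=
      measurableSet_le measurable_const (by fun_prop)
    exact h1.union
      (measurableSet_le measurable_const (measurable_subtype_coe.comp hM.measurable_f).enorm)
  have hBm : MeasurableSet B := hmp.measurable hB0
  have hBα : ((stdGaussian (EuclideanSpace ℝ (Fin n))).prod ν).real B ≤ α / 8 := by
    refine ENNReal.toReal_le_of_le_ofReal (by positivity) ?_
    rw [hBdef, hmp.measure_preimage hB0.nullMeasurableSet, hβ]
    exact measure_large_signal_or_output_le hM.measurable_f hα0 hN0 hN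
  have hzz : inner ℝ z z = 1 := by rw [real_inner_self_eq_norm_sq, hx₀, one_pow]
  have hsqη : ∀ q : ℝ × Θ, (lossDeriv L (μ * q.1) (f q.1 q.2) * q.1) ^ 2
      = lossDeriv L (μ * q.1) (f q.1 q.2) ^ 2 * q.1 ^ 2 := fun q => mul_pow _ _ _
  obtain ⟨W, hWm, hW, hgood⟩ := exists_good_event (ν := ν) hTle hT0 hT1 (z := z) hx₀
    (F := fun p => lossDeriv L (μ * inner ℝ z p.1) (f (inner ℝ z p.1) p.2))
    (hΞ.comp hmp.measurable)
    (fun b b' θ => by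
      have : inner ℝ z (inner ℝ z b • z + projOrth z b') = inner ℝ z b := by
        simp only [projOrth_apply, inner_add_right, inner_sub_right, real_inner_smul_right, hzz]
        ring
      simp only [this])
    (hmp.integrable_comp_of_integrable hμ.integrable_σ) hμ.nonneg_σ
    (hμ.eq_σ.trans (hint (hΞ.pow_const 2)).symm) (η := η)
    (((memLp_two_iff_integrable_sq (hΞ.mul measurable_fst).aestronglyMeasurable).2
      (hμ.integrable_η.congr (Filter.Eventually.of_forall fun q => (hsqη q).symm))).comp_measurePreserving
        hmp)
    ((hint (hΞ.mul measurable_fst)).trans hμ.eq_μ.symm)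
    (hμ.eq_η.trans ((integral_congr_ae (Filter.Eventually.of_forall fun q => (hsqη q).symm)).trans
      (hint ((hΞ.mul measurable_fst).pow_const 2)).symm))
    hα hBm hBα (m := m) (hw ▸ hm1) (hw ▸ hm2) hτ
  rw [← hw] at hgood
  -- The failure set need not be measurable, since y' is arbitrary. It is covered by the preimage of
  -- W, which involves only the whitened sample.
  refine (measure_mono (t := (fun ω i => (R (a i ω), θ i ω)) ⁻¹' W) fun ω hω => ?_).trans ?_
  swap
  · rw [← Measure.map_apply_of_aemeasurable hX.aemeasurable hWm, hX.map_eq]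
    exact hW
  by_contra hnot
  obtain ⟨hlt, x, hx, hxt⟩ := hω
  obtain ⟨hq, hh, hι, h4, h5⟩ := hgood _ hnot
  have hinner : ∀ i x, inner ℝ (a i ω) x = inner ℝ (R (a i ω)) (sqrtCov S x) := fun i x => by
    rw [← inner_sqrtCov, hR2]
  obtain ⟨h, hhT, hh1, hle⟩ := hx.exists_direction (S := S) hconv hK hμK ht (not_le.1 hxt)
  have hhT' : h ∈ T := by rw [hT]; exact ⟨hhT, hh1.le⟩
  have hle := hle _ hinner
  have hobs : ∀ i, inner ℝ (a i ω) x₀ = inner ℝ z (R (a i ω)) := fun i => by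
    rw [hinner, real_inner_comm]
  simp only [inner_smul_right, hobs] at hle
  have hy : ∀ i, observation a θ f x₀ ω i = f (inner ℝ z (R (a i ω))) (θ i ω) := fun i => by
    rw [observation, hobs]
  -- A finite curvature radius below M. With κ = 16β|μ|/α it is at least the average of 32t and 2κ,
  -- namely 16t + κ > κ + 2t.
  set r := max (32 * t) (32 * β / α * |μ|) with hr
  have hr0 : 0 < r := lt_max_of_lt_left (by positivity)
  have hcore := le_sum_loss_increment (y := observation a θ f x₀ ω) (y' := y' ω) (μ := μ) (r := r)
    (κ := 16 * β / α * |μ|) (Q₁ := √m * η / τ) (Q₂ := √m * σ * w / τ) hsm hconv hLip hCMN hCLip ht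
    (by
      have h6 : 32 * t ≤ r := le_max_left _ _
      have h7 : 32 * β / α * |μ| ≤ r := le_max_right _ _
      have h8 : 32 * β / α * |μ| = 2 * (16 * β / α * |μ|) := by ring
      linarith) hx₀ hh1 (ι := fun i => B.indicator 1 (R (a i ω), θ i ω))
    (fun i => by
      by_cases hmem : (R (a i ω), θ i ω) ∈ B
      · exact Or.inl (Set.indicator_of_mem hmem _)
      · refine Or.inr ⟨Set.indicator_of_notMem hmem _, ?_⟩
        simp only [hBdef, Set.mem_preimage, Set.mem_ofPred_eq, not_or, not_le] at hmem
        refine ⟨?_, fun s hs => hcurv s _ ?_ ?_⟩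
        · rw [abs_mul, mul_comm]
          exact mul_le_mul_of_nonneg_right hmem.1.le (abs_nonneg _)
        · refine lt_of_lt_of_le ?_ hMle
          rw [← ofReal_norm, Real.norm_eq_abs]
          exact (ENNReal.ofReal_lt_ofReal_iff hr0).2 hs
        · rw [hy]
          exact hmem.2)
    hι (hq h hhT') (hh h hhT' hh1)
    (by
      simp only [hy]
      refine abs_le_of_sq_le_sq ?_ (by have := hμ.nonneg_η; positivity)
      refine h4.trans ?_
      rw [div_pow, mul_pow, Real.sq_sqrt hm'.le]
      -- Since τ ≤ 1, 1/τ may be weakened to 1/τ², so both linear terms carry the same factor 1/τ.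
      refine div_le_div_of_nonneg_left (by positivity) (by positivity) ?_
      nlinarith)
    (by
      simp only [hy]
      refine le_trans ?_ h5
      have : Nonempty T := ⟨⟨h, hhT'⟩⟩
      simpa only [Pi.zero_apply, zero_add] using le_affSup hTle bddAbove_range_zero _ ⟨h, hhT'⟩)
  have h9 := hcore.trans hle
  set ε := advNoise (observation a θ f x₀ ω) (y' ω) with hε
  have hε0 : 0 ≤ ε := Real.sqrt_nonneg _
  have hs0 : 0 < √(m : ℝ) := Real.sqrt_pos.2 hm'
  have hss : √(m : ℝ) * √m = m := Real.mul_self_sqrt hm'.le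
  have hη0 := hμ.nonneg_η
  have hσ0 := hμ.nonneg_σ
  have hqn : 0 ≤ (σ * w + η) / √(m : ℝ) := by positivity
  -- compare both sides after division by `t * m`
  have h10 : CMN * α / 4 * t ≤ (σ * w + η) / √m * (1 / τ) + 10 * CLip * ε := by
    have e1 : (σ * w + η) / √(m : ℝ) * (1 / τ) * m = √m * η / τ + √m * σ * w / τ := by
      field_simp
      linear_combination (-(σ * w + η)) * hss
    have e2 : (CMN * α / 4 * t) * (t * m)
        ≤ ((σ * w + η) / √m * (1 / τ) + 10 * CLip * ε) * (t * m) := by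
      have e3 : ((σ * w + η) / √m * (1 / τ) + 10 * CLip * ε) * (t * m)
          = t * ((σ * w + η) / √(m : ℝ) * (1 / τ) * m) + 10 * CLip * t * m * ε := by ring
      rw [e3, e1]
      linarith
    exact le_of_mul_le_mul_right e2 (by positivity)
  have h11 : (σ * w + η) / √m * (1 / τ) + 10 * CLip * ε
      ≤ (1 / τ + 10 * CLip) * ((σ * w + η) / √(m : ℝ) + ε) := by
    have : 0 ≤ 1 / τ * ε := by positivity
    have : 0 ≤ 10 * CLip * ((σ * w + η) / √(m : ℝ)) := by positivity
    linarith
  have h12 : CMN * α / 4 * t ≤ CMN * α / 4 * (4 / (CMN * α) * (1 / τ + 10 * CLip) *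
      ((σ * w + η) / √(m : ℝ) + ε)) := by
    refine (h10.trans h11).trans (le_of_eq ?_)
    field_simp
  exact absurd (le_of_mul_le_mul_left h12 (by positivity)) (not_le.2 hlt)

end Recovery

/-! ### Choice of the constants and conclusion. -/

theorem mainTheorem3 :
    -- numerical constants: `κ₁`, `κ₂` calibrate the curvature region, `C₁` the sample size
    ∃ κ₁ > (0 : ℝ), ∃ κ₂ > (0 : ℝ), ∃ C₁ > (0 : ℝ), ∃ c > (0 : ℝ),
    -- `C₂` depends only on the failure probability, the curvature and the Lipschitz constant
    ∀ δ : ℝ, 0 < δ → δ < 1 → ∀ CMN : ℝ, 0 < CMN → ∀ CLip : ℝ, 0 < CLip → ∃ C₂ > (0 : ℝ),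
    ∀ {Ω Θ : Type*} [MeasurableSpace Ω] [MeasurableSpace Θ]
      (P : Measure Ω) [IsProbabilityMeasure P] (ν : Measure Θ) [IsProbabilityMeasure ν]
      (n m : ℕ) (Y : Set ℝ) (_ : IsClosed Y)
      (S : Matrix (Fin n) (Fin n) ℝ) (_ : S.PosDef)
      (a : Fin m → Ω → EuclideanSpace ℝ (Fin n)) (θ : Fin m → Ω → Θ) (f : ℝ → Θ → Y)
      (_ : IsMeasurementModel P ν S a θ f)
      (x₀ : EuclideanSpace ℝ (Fin n)) (_ : ‖sqrtCov S x₀‖ = 1)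
      -- the actual, arbitrarily perturbed observations
      (y' : Ω → Fin m → Y)
      (L : ℝ → Y → ℝ) (_ : LossLipschitz L CLip) (_ : LossConvex L) (_ : LossSmooth L)
      (μ σ η : ℝ) (_ : IsModelParameter ν f L μ σ η)
      (K : Set (EuclideanSpace ℝ (Fin n))) (_ : Convex ℝ K) (_ : μ • x₀ ∈ K)
      (t : ℝ) (_ : 0 < t)
      (M N : ℝ≥0∞) (_ : 0 < M) (_ : 0 < N)
      (_ : ENNReal.ofReal (max (32 * t) (κ₁ * |μ|)) ≤ M) (_ : LossCurved L M N CMN)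
      (d : ℝ) (_ : d = effDim t ((fun x => sqrtCov S (x - μ • x₀)) '' K))
      (_ : C₁ * d ≤ (m : ℝ))
      -- the event that all hypotheses on the perturbation hold but the recovery fails
      (bad : Set Ω)
      (_ : bad = {ω | ENNReal.ofReal κ₂ * meanAbsOutput ν f
              + maxNoise (observation a θ f x₀ ω) (y' ω) ≤ N ∧
            C₂ * ((σ * √d + η) / √(m : ℝ) + advNoise (observation a θ f x₀ ω) (y' ω)) < t ∧
            ∃ x, IsEstimator L K (fun i => a i ω) (y' ω) x ∧
              ¬ ‖sqrtCov S (x - μ • x₀)‖ ≤ t}),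
      P bad ≤ ENNReal.ofReal (δ + Real.exp (-c * m)) ∧
      (C₁ * Real.log (2 / δ) * d ≤ (m : ℝ) → P bad ≤ ENNReal.ofReal δ) := by
  set α := ∫ s, hat s ∂gaussianReal 0 1 with hα
  set β := ∫ s, |s| ∂gaussianReal 0 1 with hβ
  have hα0 : 0 < α := integral_hat_pos
  have hβ0 : 0 < β := integral_abs_gaussianReal_pos
  set c := α ^ 2 / 256 with hc
  have hc0 : 0 < c := by positivity
  -- The three summands secure 2w² ≤ m, 32w ≤ α√m and, through d ≥ β²/4, the bound c m ≥ 2.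
  set C₁ := 2 + (32 / α) ^ 2 + 8 / (c * β ^ 2) with hC₁
  refine ⟨32 * β / α, by positivity, 16 / α, by positivity, C₁, by positivity, c, hc0, ?_⟩
  intro δ hδ0 hδ1 CMN hCMN CLip hCLip
  -- The Markov level is τ = δ/4, so the two Markov bounds together cost δ/2.
  refine ⟨4 / (CMN * α) * (1 / (δ / 4) + 10 * CLip), by positivity, ?_⟩
  intro Ω Θ _ _ P _ ν _ n m Y _ S hS a θ f hM x₀ hx₀ y' L hLip hconv hsm μ σ η hμ K hK hμK t ht
    M N _ hN0 hMle hcurv d hd hmd bad hbad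
  -- One failing realization already yields a unit vector in T, hence the lower bound on d and m >
  -- 0. It also gives the output condition on N, which does not involve ω.
  rcases bad.eq_empty_or_nonempty with hempty | ⟨ω₀, hω₀⟩
  · simp [hempty]
  rw [hbad] at hω₀
  obtain ⟨hN, _, x, hx, hxt⟩ := hω₀
  set V := (fun x => sqrtCov S (x - μ • x₀)) '' K
  set T : Set (EuclideanSpace ℝ (Fin n)) := {x | t • x ∈ V ∧ ‖x‖ ≤ 1} with hT
  obtain ⟨h, hhV, hh1, -⟩ := hx.exists_direction (S := S) hconv hK hμK ht (not_le.1 hxt)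
  have hT1 : ∃ x ∈ T, ‖x‖ = 1 := ⟨h, ⟨hhV, hh1.le⟩, hh1⟩
  have hT0 : (0 : EuclideanSpace ℝ (Fin n)) ∈ T := ⟨⟨_, hμK, by simp⟩, by simp⟩
  have hβw := integral_abs_le_integral_affSup_zero (fun x hx => hx.2) hT0
    (⟨hhV, hh1.le⟩ : h ∈ T) hh1
  rw [← hβ] at hβw
  set w := ∫ g, affSup T 0 g ∂stdGaussian (EuclideanSpace ℝ (Fin n)) with hw
  have hw0 : 0 < w := lt_of_lt_of_le (by positivity) hβw
  have hdw : d = w ^ 2 := by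
    rw [hd, effDim, localMeanWidth_eq ht, ← hw]
    field_simp
  have hsd : √d = w := by rw [hdw, Real.sqrt_sq hw0.le]
  have hdβ : β ^ 2 / 4 ≤ d := by
    rw [hdw]
    nlinarith
  have hd0 : 0 < d := by rw [hdw]; positivity
  have hm' : (0 : ℝ) < m := lt_of_lt_of_le (by positivity) hmd
  have hsplit : C₁ * d = 2 * d + (32 / α) ^ 2 * d + 8 / (c * β ^ 2) * d := by rw [hC₁]; ring
  have hpos1 : 0 ≤ (32 / α) ^ 2 * d := by positivity
  have hpos2 : 0 ≤ 8 / (c * β ^ 2) * d := by positivity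
  have hcC : 2 ≤ c * (C₁ * d) := by
    have h1 : c * (8 / (c * β ^ 2) * (β ^ 2 / 4)) = 2 := by field_simp; norm_num
    have h2 : 8 / (c * β ^ 2) * (β ^ 2 / 4) ≤ 8 / (c * β ^ 2) * d := by gcongr
    rw [← h1]
    exact mul_le_mul_of_nonneg_left (by linarith) hc0.le
  have hm2 : 32 * w ≤ α * √m := by
    have h1 : 32 / α * w ≤ √m := by
      refine Real.le_sqrt_of_sq_le ?_
      rw [mul_pow, ← hdw]
      linarith
    rw [div_mul_eq_mul_div, div_le_iff₀ hα0] at h1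
    linarith
  have hfail : P bad ≤ ENNReal.ofReal (δ / 2 + Real.exp (-c * m)) := by
    have h1 := measure_recovery_failure_le hS hM hx₀ y' hCLip hCMN hLip hconv hsm hμ hK hμK ht hN0 hα
      hβ (by positivity : 0 < δ / 4) (by linarith) hMle hcurv (le_self_add.trans hN) hT hT1 hw
      (by exact_mod_cast hm') (by rw [← hdw]; linarith) hm2
    rw [hbad, hsd]
    refine (measure_mono fun ω hω => hω.2).trans (h1.trans (ENNReal.ofReal_le_ofReal ?_))
    -- As α²/128 = 2c, one factor exp(-cm) ≤ 1/3 absorbs the 3 and the other remains.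
    have h2 : Real.exp (-(α ^ 2 / 128 * m)) = Real.exp (-c * m) * Real.exp (-c * m) := by
      rw [← Real.exp_add, hc]
      ring_nf
    have h3 : 3 * Real.exp (-c * m) ≤ 1 := by
      have h4 : (3 : ℝ) ≤ Real.exp (c * m) := by
        have h5 := Real.add_one_le_exp (c * m)
        have h6 := mul_le_mul_of_nonneg_left hmd hc0.le
        linarith
      rw [neg_mul, Real.exp_neg, ← div_eq_mul_inv, div_le_one (Real.exp_pos _)]
      exact h4
    rw [h2]
    have := mul_le_mul_of_nonneg_right h3 (Real.exp_nonneg (-c * m))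
    linarith
  refine ⟨hfail.trans (ENNReal.ofReal_le_ofReal (by linarith)), fun hlog => ?_⟩
  refine hfail.trans (ENNReal.ofReal_le_ofReal ?_)
  -- The larger sample size gives c m ≥ 2 log(2/δ), so exp(-cm) fits into the unused δ/2.
  have h1 : 0 < Real.log (2 / δ) := Real.log_pos (by rw [lt_div_iff₀ hδ0]; linarith)
  have h2 : Real.log (2 / δ) ≤ c * m := by
    have h3 := mul_le_mul_of_nonneg_left hlog hc0.le
    have h4 := mul_le_mul_of_nonneg_right hcC h1.le
    linarith
  have h5 : Real.exp (-c * m) ≤ δ / 2 := by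
    rw [neg_mul, Real.exp_neg, inv_le_comm₀ (Real.exp_pos _) (by positivity), inv_div]
    exact (Real.log_le_iff_le_exp (by positivity)).1 h2
  linarith
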